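/- Let $\mathbb T=\mathbb R/2\pi\mathbb Z$, $\hat f_k=\frac1{2\pi}\int_{\mathbb T}e^{-ikx}f(x)\,dx$, $\Pi_0(f)=\hat f_0$, and $\|f\|_{H^1}^2=2\pi\sum_{k\in\mathbb Z}(1+k^2)|\hat f_k|^2$. Let $\partial_x^{-1}$ be the Fourier multiplier with symbol $(ik)^{-1}$ for $k\neq0$ and $0$ for $k=0$, and $\partial_x^{-2}=(\partial_x^{-1})^2$. For $u_0\in H^1(\mathbb T)$ let $u\in C([0,T];H^1(\mathbb T))$ be a solution of the cubic nonlinear Schrödinger equation $$ i\partial_tu+\partial_{xx}u-|u|^2u=0,\qquad u(0)=u_0 .$$ Put $M_0=\Pi_0(|u_0|^2)$ and $P_0=\Pi_0(u_0\,\partial_x\overline{u_0})$. For a time step $\tau>0$ let $u^0=u_0$ and $u^{n+1}=\Psi(u^n)$, where $$\begin{aligned}\Psi(f)=\;&e^{i\tau(-2M_0-2P_0\partial_x^{-1}+\partial_x^2)}f-i\tau\,\Pi_0(|f|^2f)+2i\tau M_0\,\Pi_0(f)\\ &-\tfrac12\partial_x^{-2}\big[(e^{-i\tau\partial_x^2}\bar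 f)\cdot e^{i\tau\partial_x^2}(f^2)\big]+\tfrac12e^{i\tau\partial_x^2}\partial_x^{-2}\big[|f|^2f\big]\\ &+\partial_x^{-1}\big[(e^{i\tau\partial_x^2}f)\cdot\partial_x^{-1}\big(|e^{i\tau\partial_x^2}f|^2\big)\big]-e^{i\tau\partial_x^2}\partial_x^{-1}\big[f\cdot\partial_x^{-1}(|f|^2)\big].\end{aligned}$$ **Corollary 1.2.** Let $T>0$ and $R\ge0$. There is $\tau_0>0$ depending only on $T$ and $R$, and for every $\varepsilon>0$ there is $C>0$ depending only on $T$, $R$ and $\varepsilon$, such that for all $u_0\in H^1(\mathbb T)$ and all such solutions $u$ with $\|u\|_{L^\infty((0,T);H^1)}\le R$, all $0<\tau\le\tau_0$ and all integers $n\ge0$ with $t_n=n\tau\le T$, $$\|u(t_n)-u^n\|_{H^1}\le C\,\tau^{\frac12-\varepsilon}.$$ -/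

import Mathlib

open MeasureTheory Set Filter Topology AddCircle
open scoped ENNReal NNReal ComplexConjugate

noncomputable section

namespace NLSTorus

/-- The torus `ℝ / 2πℤ`. -/
abbrev Torus : Type := AddCircle (2 * Real.pi)

instance factTwoPiPos : Fact (0 < 2 * Real.pi) := ⟨Real.two_pi_pos⟩

/-- The normalized measure `dx / (2π)` on the torus. -/
abbrev normMeasure : Measure Torus := haarAddCircle

/-- The Fourier coefficient `(2π)⁻¹ ∫ e^{-ikx} f(x) dx`. -/
abbrev coeff (f : Torus → ℂ) (k : ℤ) : ℂ := fourierCoeff f k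

/-- The zero mode `(2π)⁻¹ ∫ f(x) dx`. -/
def zeroMode (f : Torus → ℂ) : ℂ := ∫ x, f x ∂normMeasure

/-- `f ∈ H¹`: `f` is square integrable and `∑ₖ (1 + k²) |f̂ₖ|² < ∞`. -/
def MemH1 (f : Torus → ℂ) : Prop :=
  MemLp f 2 normMeasure ∧ Summable fun k : ℤ => (1 + (k : ℝ) ^ 2) * ‖coeff f k‖ ^ 2

/-- The norm `(2π ∑ₖ (1 + k²) |f̂ₖ|²)^{1/2}`; meaningful for `f` with `MemH1 f`. -/
def h1Norm (f : Torus → ℂ) : ℝ :=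
  Real.sqrt (2 * Real.pi * ∑' k : ℤ, (1 + (k : ℝ) ^ 2) * ‖coeff f k‖ ^ 2)

/-- The norm of `u` in `L^∞((0,T); H¹)`. -/
def linftyH1Norm (T : ℝ) (u : ℝ → Torus → ℂ) : ℝ≥0∞ :=
  eLpNorm (fun t => h1Norm (u t)) ∞ (volume.restrict (Ioo 0 T))

open scoped Classical in
/-- The Fourier multiplier with symbol `m`: the function in `L²` (determined almost everywhere)
whose Fourier coefficients are `mₖ f̂ₖ`. By Riesz-Fischer it exists if and only if
`∑ₖ |mₖ f̂ₖ|² < ∞`; otherwise the value is `0`. -/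
def fourierMul (m : ℤ → ℂ) (f : Torus → ℂ) : Torus → ℂ :=
  if h : ∃ g : Torus → ℂ, MemLp g 2 normMeasure ∧ ∀ k, coeff g k = m k * coeff f k then
    h.choose
  else 0

/-- The symbol of `∂ₓ⁻¹`: `(ik)⁻¹` for `k ≠ 0` and `0` for `k = 0`. -/
def invDerivSymbol (k : ℤ) : ℂ := if k = 0 then 0 else (Complex.I * (k : ℂ))⁻¹

/-- The (weak) derivative `∂ₓ`. -/
def deriv1 (f : Torus → ℂ) : Torus → ℂ := fourierMul (fun k => Complex.I * (k : ℂ)) f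

/-- The operator `∂ₓ⁻¹`. -/
def invDeriv (f : Torus → ℂ) : Torus → ℂ := fourierMul invDerivSymbol f

/-- The operator `∂ₓ⁻² = ∂ₓ⁻¹ ∂ₓ⁻¹`. -/
def invDeriv2 (f : Torus → ℂ) : Torus → ℂ := fourierMul (fun k => invDerivSymbol k ^ 2) f

/-- The free Schrödinger group `e^{is∂ₓ²}`. -/
def freeProp (s : ℝ) (f : Torus → ℂ) : Torus → ℂ :=
  fourierMul (fun k => Complex.exp (-Complex.I * (s : ℂ) * (k : ℂ) ^ 2)) f

/-- Pointwise complex conjugate. -/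
def cj (f : Torus → ℂ) : Torus → ℂ := fun x => conj (f x)

/-- The density `|f|²`, as a complex-valued function. -/
def absSq (f : Torus → ℂ) : Torus → ℂ := fun x => ((‖f x‖ ^ 2 : ℝ) : ℂ)

/-- The mass `M(f) = (2π)⁻¹ ∫ |f|² dx`. -/
def mass (f : Torus → ℂ) : ℂ := zeroMode (absSq f)

/-- The momentum `P(f) = (2π)⁻¹ ∫ f ∂ₓ f̄ dx`. -/
def momentum (f : Torus → ℂ) : ℂ := zeroMode (f * deriv1 (cj f))

/-- The operator `e^{iτ(-2M₀ - 2P₀ ∂ₓ⁻¹ + ∂ₓ²)}`. -/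
def linearPart (τ : ℝ) (M₀ P₀ : ℂ) (f : Torus → ℂ) : Torus → ℂ :=
  fourierMul (fun k => Complex.exp
    (Complex.I * (τ : ℂ) * (-2 * M₀ - 2 * P₀ * invDerivSymbol k - (k : ℂ) ^ 2))) f

/-- One step `Ψ` of the Fourier integrator, with time step `τ`, for the data `M₀`, `P₀`. -/
def step (τ : ℝ) (M₀ P₀ : ℂ) (f : Torus → ℂ) : Torus → ℂ := fun x =>
  linearPart τ M₀ P₀ f x
    - Complex.I * (τ : ℂ) * zeroMode (absSq f * f)
    + 2 * Complex.I * (τ : ℂ) * M₀ * zeroMode f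
    - (1 / 2 : ℂ) * invDeriv2 (freeProp (-τ) (cj f) * freeProp τ (f * f)) x
    + (1 / 2 : ℂ) * freeProp τ (invDeriv2 (absSq f * f)) x
    + invDeriv (freeProp τ f * invDeriv (absSq (freeProp τ f))) x
    - freeProp τ (invDeriv (f * invDeriv (absSq f))) x

/-- The numerical solution `uⁿ`: `u⁰ = u₀`, `uⁿ⁺¹ = Ψ(uⁿ)`, with `M₀`, `P₀` the mass and
momentum of `u₀`. -/
def numSol (τ : ℝ) (u₀ : Torus → ℂ) : ℕ → Torus → ℂ
  | 0 => u₀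
  | n + 1 => step τ (mass u₀) (momentum u₀) (numSol τ u₀ n)

/-- `u ∈ C([0,T]; H¹)` solves `i ∂ₜu + ∂ₓₓu - |u|²u = 0` on `(0,T) × 𝕋` with `u(0) = u₀`. The
equation is understood in the sense of periodic distributions in `x`, that is, it holds when
tested against every `e^{-ikx}`, `k ∈ ℤ`. -/
structure IsNLSSolution (T : ℝ) (u₀ : Torus → ℂ) (u : ℝ → Torus → ℂ) : Prop where
  memH1 : ∀ t ∈ Icc 0 T, MemH1 (u t)
  continuous_H1 : ∀ t ∈ Icc 0 T, Tendsto (fun s => h1Norm (u s - u t)) (𝓝[Icc 0 T] t) (𝓝 0)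
  initial : u 0 =ᵐ[normMeasure] u₀
  equation : ∀ t ∈ Ioo 0 T, ∀ k : ℤ, ∃ d : ℂ,
    HasDerivAt (fun s => coeff (u s) k) d t ∧
      Complex.I * d - (k : ℂ) ^ 2 * coeff (u t) k - coeff (absSq (u t) * u t) k = 0

end NLSTorus

end

noncomputable section

namespace NLSTorus

/-! ### Weighted sequence spaces -/

/-! All estimates live on Fourier coefficients in `ℓ²(⟨k⟩²)`. Filtering the solution by the free
group (`twist`) removes the unbounded term `k² û_k`. Up to `O(τ²)`, one time step then adds to the
filtered solution the trilinear form with symbol `-i ∫₀^τ e^{ixΦ} dx`, where `Φ = 2(p+q)(p+r)` and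
`k = p+q+r`, with `p` the frequency of the conjugated factor (`SeqSolution.duhamel`).

The scheme rests on `k = (p+q) + (p+r) - p`. For `k ≠ 0`, dividing by `k` and using the symmetry
between `q` and `r` replaces the weight `1` by `2(p+r)/k - p/k`. In the first piece `p+r` cancels a
factor of `Φ` and the time integral is kept exactly; its resonances `p+q = 0` sum to the mass and
momentum terms of the linear part. In the second piece `Φ = 2kp + 2qr` is frozen to `2kp`, which
again integrates exactly. Freezing costs `τ (τ⟨q⟩⟨r⟩)^θ`, while `p/k` moves the `H¹` weight from the
output onto `p`. So `q` and `r` only need `⟨·⟩^θ a ∈ ℓ¹`, which `H¹` provides for `θ < 1/2`; this is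
the origin of the rate (`duhamelSymbol_add_antiSymbol`, `symbolBound_errSymbol`, `local_error`).

The local error involves the mass and momentum of `u(t)`, the scheme those of `u₀`; they agree by
`SeqSolution.conserved`. One step is Lipschitz with constant `1 + Kτ` on bounded sets (`stability`),
so a discrete Gronwall argument sums the local errors `τ^{1+θ}` to `τ^θ`. Boundedness of the
numerical solution is obtained first, with the fixed exponent `θ = 1/4`; this keeps `τ₀` independent
of `ε`. -/

/-- The Japanese bracket `⟨k⟩ = (1 + k²)^{1/2}`. -/
def jap (k : ℤ) : ℝ := √(1 + (k : ℝ) ^ 2)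

lemma jap_sq (k : ℤ) : jap k ^ 2 = 1 + (k : ℝ) ^ 2 := Real.sq_sqrt (by positivity)

lemma one_le_jap (k : ℤ) : 1 ≤ jap k := by
  rw [jap, Real.one_le_sqrt]; nlinarith [sq_nonneg (k : ℝ)]

lemma jap_pos (k : ℤ) : 0 < jap k := lt_of_lt_of_le one_pos (one_le_jap k)

lemma abs_le_jap (k : ℤ) : |(k : ℝ)| ≤ jap k := by
  rw [jap]; exact Real.abs_le_sqrt (by linarith)

lemma jap_le_one_add_abs (k : ℤ) : jap k ≤ 1 + |(k : ℝ)| := by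
  rw [jap, Real.sqrt_le_left (by positivity)]
  nlinarith [abs_nonneg (k : ℝ), sq_abs (k : ℝ)]

lemma jap_add_le (p q : ℤ) : jap (p + q) ≤ jap p + jap q := by
  have h1 := jap_sq p
  have h2 := jap_sq q
  have h3 : (p : ℝ) * q ≤ jap p * jap q :=
    (le_abs_self _).trans (by
      rw [abs_mul]
      exact mul_le_mul (abs_le_jap p) (abs_le_jap q) (abs_nonneg _) (jap_pos p).le)
  rw [jap, Real.sqrt_le_left (by have := jap_pos p; have := jap_pos q; positivity)]
  push_cast
  nlinarith

/-- Membership in the weighted space `ℓ²(⟨k⟩²)`. -/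
def SeqH1 (a : ℤ → ℂ) : Prop := Summable fun k : ℤ => (1 + (k : ℝ) ^ 2) * ‖a k‖ ^ 2

/-- The norm of `ℓ²(⟨k⟩²)`. -/
def seqNorm (a : ℤ → ℂ) : ℝ := √(∑' k : ℤ, (1 + (k : ℝ) ^ 2) * ‖a k‖ ^ 2)

lemma seqNorm_nonneg (a : ℤ → ℂ) : 0 ≤ seqNorm a := Real.sqrt_nonneg _

lemma seqNorm_sq (a : ℤ → ℂ) :
    seqNorm a ^ 2 = ∑' k : ℤ, (1 + (k : ℝ) ^ 2) * ‖a k‖ ^ 2 :=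
  Real.sq_sqrt (tsum_nonneg fun _ => by positivity)

lemma norm_jap_mul_sq (a : ℤ → ℂ) (k : ℤ) :
    ‖(jap k : ℂ) * a k‖ ^ 2 = (1 + (k : ℝ) ^ 2) * ‖a k‖ ^ 2 := by
  rw [norm_mul, mul_pow, Complex.norm_real, Real.norm_eq_abs, sq_abs, jap_sq]

lemma memℓp_jap_mul_iff (a : ℤ → ℂ) :
    Memℓp (fun k => (jap k : ℂ) * a k) 2 ↔ SeqH1 a := by
  rw [memℓp_gen_iff (by norm_num)]
  simp only [ENNReal.toReal_ofNat, Real.rpow_two]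
  rw [SeqH1]
  exact summable_congr fun k => norm_jap_mul_sq a k

/-- The weighted sequence as an element of `ℓ²`. -/
def SeqH1.toLp {a : ℤ → ℂ} (ha : SeqH1 a) : lp (fun _ : ℤ => ℂ) 2 :=
  ⟨fun k => (jap k : ℂ) * a k, (memℓp_jap_mul_iff a).2 ha⟩

lemma SeqH1.norm_toLp {a : ℤ → ℂ} (ha : SeqH1 a) : ‖ha.toLp‖ = seqNorm a := by
  rw [lp.norm_eq_tsum_rpow (by norm_num), seqNorm, Real.sqrt_eq_rpow]
  simp only [ENNReal.toReal_ofNat, Real.rpow_two]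
  congr 1
  exact tsum_congr fun k => norm_jap_mul_sq a k

lemma SeqH1.add {a b : ℤ → ℂ} (ha : SeqH1 a) (hb : SeqH1 b) : SeqH1 (a + b) := by
  rw [← memℓp_jap_mul_iff] at *
  convert ha.add hb using 2 with k
  simp [mul_add]

lemma seqNorm_add_le {a b : ℤ → ℂ} (ha : SeqH1 a) (hb : SeqH1 b) :
    seqNorm (a + b) ≤ seqNorm a + seqNorm b := by
  rw [← ha.norm_toLp, ← hb.norm_toLp, ← (ha.add hb).norm_toLp]
  have h : (ha.add hb).toLp = ha.toLp + hb.toLp := by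
    ext k
    simp [SeqH1.toLp, mul_add]
    rfl
  rw [h]
  exact norm_add_le _ _

lemma SeqH1.of_le {a b : ℤ → ℂ} (hb : SeqH1 b) (C : ℝ) (h : ∀ k, ‖a k‖ ≤ C * ‖b k‖) :
    SeqH1 a := by
  refine Summable.of_nonneg_of_le (fun k => by positivity) (fun k => ?_) (hb.mul_left (C ^ 2))
  have h2 : ‖a k‖ ^ 2 ≤ (C * ‖b k‖) ^ 2 := pow_le_pow_left₀ (norm_nonneg _) (h k) 2
  have : (0 : ℝ) ≤ 1 + (k : ℝ) ^ 2 := by positivity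
  nlinarith [mul_le_mul_of_nonneg_left h2 this]

lemma seqNorm_le_of_le {a b : ℤ → ℂ} (hb : SeqH1 b) {C : ℝ} (hC : 0 ≤ C)
    (h : ∀ k, ‖a k‖ ≤ C * ‖b k‖) : seqNorm a ≤ C * seqNorm b := by
  rw [seqNorm, Real.sqrt_le_left (mul_nonneg hC (seqNorm_nonneg b)), mul_pow, seqNorm_sq,
    ← tsum_mul_left]
  refine (hb.of_le C h).tsum_le_tsum (fun k => ?_) (hb.mul_left _)
  have h2 : ‖a k‖ ^ 2 ≤ (C * ‖b k‖) ^ 2 := pow_le_pow_left₀ (norm_nonneg _) (h k) 2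
  have : (0 : ℝ) ≤ 1 + (k : ℝ) ^ 2 := by positivity
  nlinarith [mul_le_mul_of_nonneg_left h2 this]

lemma seqNorm_congr {a b : ℤ → ℂ} (h : ∀ k, ‖a k‖ = ‖b k‖) : seqNorm a = seqNorm b := by
  simp only [seqNorm, h]

lemma SeqH1.congr {a b : ℤ → ℂ} (ha : SeqH1 a) (h : ∀ k, ‖b k‖ = ‖a k‖) : SeqH1 b :=
  ha.of_le 1 fun k => by rw [h, one_mul]

lemma SeqH1.neg {a : ℤ → ℂ} (ha : SeqH1 a) : SeqH1 (-a) := ha.congr fun k => by simp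

lemma seqNorm_neg (a : ℤ → ℂ) : seqNorm (-a) = seqNorm a := seqNorm_congr fun k => by simp

lemma SeqH1.sub {a b : ℤ → ℂ} (ha : SeqH1 a) (hb : SeqH1 b) : SeqH1 (a - b) := by
  rw [sub_eq_add_neg]; exact ha.add hb.neg

lemma seqNorm_sub_le {a b : ℤ → ℂ} (ha : SeqH1 a) (hb : SeqH1 b) :
    seqNorm (a - b) ≤ seqNorm a + seqNorm b := by
  rw [sub_eq_add_neg, ← seqNorm_neg b]; exact seqNorm_add_le ha hb.neg

lemma jap_mul_norm_le {a : ℤ → ℂ} (ha : SeqH1 a) (k : ℤ) : jap k * ‖a k‖ ≤ seqNorm a := by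
  rw [seqNorm]
  refine Real.le_sqrt_of_sq_le ?_
  rw [mul_pow, jap_sq]
  exact ha.le_tsum k fun j _ => by positivity

lemma norm_le_seqNorm {a : ℤ → ℂ} (ha : SeqH1 a) (k : ℤ) : ‖a k‖ ≤ seqNorm a :=
  le_trans (le_mul_of_one_le_left (norm_nonneg _) (one_le_jap k)) (jap_mul_norm_le ha k)

lemma ofReal_weighted (a : ℤ → ℂ) (k : ℤ) :
    ENNReal.ofReal ((1 + (k : ℝ) ^ 2) * ‖a k‖ ^ 2) = (ENNReal.ofReal (jap k) * ‖a k‖ₑ) ^ 2 := by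
  rw [← jap_sq, ← mul_pow, ENNReal.ofReal_pow (mul_nonneg (jap_pos k).le (norm_nonneg _)),
    ENNReal.ofReal_mul (jap_pos k).le, ofReal_norm]

lemma SeqH1.tsum_enorm {a : ℤ → ℂ} (ha : SeqH1 a) :
    ∑' k, (ENNReal.ofReal (jap k) * ‖a k‖ₑ) ^ 2 = ENNReal.ofReal (seqNorm a) ^ 2 := by
  rw [← ENNReal.ofReal_pow (seqNorm_nonneg a), seqNorm_sq,
    ENNReal.ofReal_tsum_of_nonneg (fun k => by positivity) ha]
  exact tsum_congr fun k => (ofReal_weighted a k).symm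

lemma seqH1_of_tsum_le {a : ℤ → ℂ} {B : ℝ} (hB : 0 ≤ B)
    (h : ∑' k, (ENNReal.ofReal (jap k) * ‖a k‖ₑ) ^ 2 ≤ ENNReal.ofReal B ^ 2) :
    SeqH1 a ∧ seqNorm a ≤ B := by
  have hs : SeqH1 a := by
    have h1 : ∑' k : ℤ, ENNReal.ofReal ((1 + (k : ℝ) ^ 2) * ‖a k‖ ^ 2) ≠ ∞ := by
      simp only [ofReal_weighted]
      exact ne_top_of_le_ne_top (by simp) h
    have h2 := ENNReal.summable_toReal h1
    refine h2.congr fun k => ?_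
    rw [ENNReal.toReal_ofReal (by positivity)]
  refine ⟨hs, ?_⟩
  rw [hs.tsum_enorm, ← ENNReal.ofReal_pow (seqNorm_nonneg a), ← ENNReal.ofReal_pow hB,
    ENNReal.ofReal_le_ofReal_iff (by positivity)] at h
  exact (le_abs_self _).trans (abs_le_of_sq_le_sq h hB)

/-! ### Young-type inequalities -/

lemma ennreal_two_mul_le (x y : ℝ≥0∞) : 2 * (x * y) ≤ x ^ 2 + y ^ 2 := by
  rcases eq_or_ne x ∞ with rfl | hx
  · simp
  rcases eq_or_ne y ∞ with rfl | hy
  · simp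
  lift x to ℝ≥0 using hx
  lift y to ℝ≥0 using hy
  norm_cast
  have := two_mul_le_add_sq x y
  rwa [mul_assoc] at this

lemma ennreal_tsum_mul_tsum {ι κ : Type*} (f : ι → ℝ≥0∞) (g : κ → ℝ≥0∞) :
    (∑' i, f i) * (∑' j, g j) = ∑' i, ∑' j, f i * g j := by
  rw [← ENNReal.tsum_mul_right]
  exact tsum_congr fun i => ENNReal.tsum_mul_left.symm

/-- The Cauchy-Schwarz inequality for series in `[0, ∞]`. -/
lemma ennreal_tsum_mul_sq_le {ι : Type*} (x y : ι → ℝ≥0∞) :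
    (∑' i, x i * y i) ^ 2 ≤ (∑' i, x i ^ 2) * ∑' i, y i ^ 2 := by
  have h2 : 2 * (∑' i, x i * y i) ^ 2 ≤ 2 * ((∑' i, x i ^ 2) * ∑' i, y i ^ 2) := by
    calc 2 * (∑' i, x i * y i) ^ 2
        = ∑' i, ∑' j, 2 * ((x i * y j) * (x j * y i)) := by
          rw [sq, ennreal_tsum_mul_tsum, ← ENNReal.tsum_mul_left]
          refine tsum_congr fun i => ?_
          rw [← ENNReal.tsum_mul_left]
          exact tsum_congr fun j => by ring
      _ ≤ ∑' i, ∑' j, ((x i * y j) ^ 2 + (x j * y i) ^ 2) :=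
          ENNReal.tsum_le_tsum fun i => ENNReal.tsum_le_tsum fun j => ennreal_two_mul_le _ _
      _ = 2 * ((∑' i, x i ^ 2) * ∑' i, y i ^ 2) := by
          simp only [ENNReal.tsum_add, two_mul, mul_pow]
          congr 1
          · rw [ennreal_tsum_mul_tsum]
          · rw [ENNReal.tsum_comm, ennreal_tsum_mul_tsum]
  exact (ENNReal.mul_le_mul_iff_right (by norm_num) (by norm_num)).1 h2

/-- Minkowski's inequality for superpositions of sequences bounded in `ℓ²`. -/
lemma ennreal_tsum_superposition_sq_le {ι κ : Type*} (y : ι → ℝ≥0∞) (x : ι → κ → ℝ≥0∞)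
    (S : ℝ≥0∞) (h : ∀ i, ∑' k, x i k ^ 2 ≤ S) :
    ∑' k, (∑' i, y i * x i k) ^ 2 ≤ (∑' i, y i) ^ 2 * S := by
  have h2 : 2 * ∑' k, (∑' i, y i * x i k) ^ 2 ≤ 2 * ((∑' i, y i) ^ 2 * S) := by
    calc 2 * ∑' k, (∑' i, y i * x i k) ^ 2
        = ∑' k, ∑' i, ∑' j, (y i * y j) * (2 * (x i k * x j k)) := by
          rw [← ENNReal.tsum_mul_left]
          refine tsum_congr fun k => ?_
          rw [sq, ennreal_tsum_mul_tsum, ← ENNReal.tsum_mul_left]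
          refine tsum_congr fun i => ?_
          rw [← ENNReal.tsum_mul_left]
          exact tsum_congr fun j => by ring
      _ ≤ ∑' k, ∑' i, ∑' j, (y i * y j) * (x i k ^ 2 + x j k ^ 2) :=
          ENNReal.tsum_le_tsum fun k => ENNReal.tsum_le_tsum fun i =>
            ENNReal.tsum_le_tsum fun j => mul_le_mul_right (ennreal_two_mul_le _ _) _
      _ = ∑' i, ∑' j, (y i * y j) * (∑' k, x i k ^ 2 + ∑' k, x j k ^ 2) := by
          rw [ENNReal.tsum_comm]
          refine tsum_congr fun i => ?_
          rw [ENNReal.tsum_comm]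
          refine tsum_congr fun j => ?_
          rw [ENNReal.tsum_mul_left, ENNReal.tsum_add]
      _ ≤ ∑' i, ∑' j, (y i * y j) * (S + S) :=
          ENNReal.tsum_le_tsum fun i => ENNReal.tsum_le_tsum fun j =>
            mul_le_mul_right (add_le_add (h i) (h j)) _
      _ = 2 * ((∑' i, y i) ^ 2 * S) := by
          simp only [ENNReal.tsum_mul_right]
          rw [sq, ennreal_tsum_mul_tsum, ← two_mul]
          ring
  exact (ENNReal.mul_le_mul_iff_right (by norm_num) (by norm_num)).1 h2

/-- A weight `g` such that `g b ∈ ℓ¹` for `b ∈ ℓ²(⟨k⟩²)`. -/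
structure IsWeight (g : ℤ → ℝ) (S : ℝ) : Prop where
  nonneg : ∀ k, 0 ≤ g k
  hasSum : HasSum (fun k => (g k / jap k) ^ 2) S

lemma IsWeight.sum_nonneg {g : ℤ → ℝ} {S : ℝ} (hg : IsWeight g S) : 0 ≤ S :=
  hg.hasSum.nonneg fun _ => sq_nonneg _

/-- Cauchy-Schwarz for the splitting `g b = (g / ⟨k⟩) · (⟨k⟩ b)`. -/
lemma IsWeight.tsum_enorm_sq_le {g : ℤ → ℝ} {S : ℝ} (hg : IsWeight g S) {b : ℤ → ℂ}
    (hb : SeqH1 b) :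
    (∑' k, ENNReal.ofReal (g k) * ‖b k‖ₑ) ^ 2
      ≤ ENNReal.ofReal S * ENNReal.ofReal (seqNorm b) ^ 2 := by
  have h1 : ∑' k, ENNReal.ofReal (g k / jap k) ^ 2 = ENNReal.ofReal S := by
    rw [← hg.hasSum.tsum_eq,
      ENNReal.ofReal_tsum_of_nonneg (fun _ => sq_nonneg _) hg.hasSum.summable]
    exact tsum_congr fun k => (ENNReal.ofReal_pow (div_nonneg (hg.nonneg k) (jap_pos k).le) 2).symm
  rw [← h1, ← hb.tsum_enorm]
  refine le_trans (le_of_eq ?_) (ennreal_tsum_mul_sq_le _ _)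
  congr 1
  refine tsum_congr fun k => ?_
  rw [← mul_assoc, ← ENNReal.ofReal_mul (div_nonneg (hg.nonneg k) (jap_pos k).le),
    div_mul_cancel₀ _ (jap_pos k).ne']

/-- For fixed `i` the inner term is a translate of `A` with mass `β i.1 * γ i.2`, so Minkowski gives
`ℓ² * ℓ¹ * ℓ¹ ⊆ ℓ²`. The two variants below permute which factor is measured in `ℓ²`. -/
lemma ennreal_young (A β γ : ℤ → ℝ≥0∞) :
    ∑' k : ℤ, (∑' i : ℤ × ℤ, (β i.1 * γ i.2) * A (k - i.1 - i.2)) ^ 2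
      ≤ (∑' k, A k ^ 2) * (∑' k, β k) ^ 2 * (∑' k, γ k) ^ 2 := by
  refine (ennreal_tsum_superposition_sq_le (fun i : ℤ × ℤ => β i.1 * γ i.2)
    (fun i k => A (k - i.1 - i.2)) (∑' k, A k ^ 2) fun i => ?_).trans (le_of_eq ?_)
  · rw [← (Equiv.subRight (i.1 + i.2)).tsum_eq (fun k => A k ^ 2)]
    simp [sub_sub]
  · rw [ENNReal.tsum_prod (f := fun i j => β i * γ j), ← ennreal_tsum_mul_tsum]
    ring

lemma ennreal_young_mid (A β γ : ℤ → ℝ≥0∞) :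
    ∑' k : ℤ, (∑' i : ℤ × ℤ, β i.1 * A i.2 * γ (k - i.1 - i.2)) ^ 2
      ≤ (∑' k, A k ^ 2) * (∑' k, β k) ^ 2 * (∑' k, γ k) ^ 2 := by
  refine le_trans (le_of_eq (tsum_congr fun k => ?_)) (ennreal_young A β γ)
  congr 1
  let e : ℤ × ℤ ≃ ℤ × ℤ :=
    ⟨fun i => (i.1, k - i.1 - i.2), fun i => (i.1, k - i.1 - i.2), fun i => by ext <;> simp,
      fun i => by ext <;> simp⟩
  rw [← e.tsum_eq]
  refine tsum_congr fun i => ?_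
  simp only [e, Equiv.coe_fn_mk]
  rw [show k - i.1 - (k - i.1 - i.2) = i.2 by ring]
  ring

lemma ennreal_young_left (A β γ : ℤ → ℝ≥0∞) :
    ∑' k : ℤ, (∑' i : ℤ × ℤ, A i.1 * β i.2 * γ (k - i.1 - i.2)) ^ 2
      ≤ (∑' k, A k ^ 2) * (∑' k, β k) ^ 2 * (∑' k, γ k) ^ 2 := by
  refine le_trans (le_of_eq (tsum_congr fun k => ?_)) (ennreal_young_mid A β γ)
  congr 1
  rw [← (Equiv.prodComm ℤ ℤ).tsum_eq]
  refine tsum_congr fun i => ?_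
  simp only [Equiv.prodComm_apply, Prod.fst_swap, Prod.snd_swap]
  rw [show k - i.2 - i.1 = k - i.1 - i.2 by ring]
  ring

/-! ### Trilinear Fourier multipliers -/

/-- The trilinear Fourier multiplier with symbol `σ`. -/
def tri (σ : ℤ → ℤ → ℤ → ℂ) (a b c : ℤ → ℂ) (k : ℤ) : ℂ :=
  ∑' i : ℤ × ℤ, σ k i.1 i.2 * (a i.1 * b i.2 * c (k - i.1 - i.2))

/-- The size condition on symbols under which `tri` is bounded on `ℓ²(⟨k⟩²)`. -/
def SymbolBound (g : ℤ → ℝ) (C : ℝ) (σ : ℤ → ℤ → ℤ → ℂ) : Prop :=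
  ∀ k p q : ℤ, ‖σ k p q‖ * jap k ≤ C * (jap p * g q * g (k - p - q)
    + g p * jap q * g (k - p - q) + g p * g q * jap (k - p - q))

lemma ennreal_add_three_sq_le (x y z : ℝ≥0∞) :
    (x + y + z) ^ 2 ≤ 3 * (x ^ 2 + y ^ 2 + z ^ 2) := by
  calc (x + y + z) ^ 2 = x ^ 2 + y ^ 2 + z ^ 2 + 2 * (x * y) + 2 * (x * z) + 2 * (y * z) := by ring
    _ ≤ x ^ 2 + y ^ 2 + z ^ 2 + (x ^ 2 + y ^ 2) + (x ^ 2 + z ^ 2) + (y ^ 2 + z ^ 2) := by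
        gcongr <;> exact ennreal_two_mul_le _ _
    _ = 3 * (x ^ 2 + y ^ 2 + z ^ 2) := by ring

section

variable {g : ℤ → ℝ} {S C : ℝ} {σ : ℤ → ℤ → ℤ → ℂ} {a b c : ℤ → ℂ}

/-- The symbol condition puts the full weight `⟨·⟩` on one input at a time. That input is measured
in `ℓ²`, the two others, with weight `g`, in `ℓ¹`. The constant `3` is the square root of `3 · 3`:
three terms, and a factor `3` from squaring their sum. Working in `[0, ∞]` lets summability come out
as a consequence. -/
lemma tri_enorm_bound (hg : IsWeight g S) (hC : 0 ≤ C) (hσ : SymbolBound g C σ)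
    (ha : SeqH1 a) (hb : SeqH1 b) (hc : SeqH1 c) :
    ∑' k : ℤ, (ENNReal.ofReal (jap k) *
      ∑' i : ℤ × ℤ, ‖σ k i.1 i.2 * (a i.1 * b i.2 * c (k - i.1 - i.2))‖ₑ) ^ 2
      ≤ ENNReal.ofReal (3 * C * S * seqNorm a * seqNorm b * seqNorm c) ^ 2 := by
  set J : (ℤ → ℂ) → ℤ → ℝ≥0∞ := fun x k => ENNReal.ofReal (jap k) * ‖x k‖ₑ with hJ
  set G : (ℤ → ℂ) → ℤ → ℝ≥0∞ := fun x k => ENNReal.ofReal (g k) * ‖x k‖ₑ with hG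
  have hj : ∀ k, 0 ≤ jap k := fun k => (jap_pos k).le
  have hg0 := hg.nonneg
  have key : ∀ (k : ℤ) (i : ℤ × ℤ), ENNReal.ofReal (jap k) *
      ‖σ k i.1 i.2 * (a i.1 * b i.2 * c (k - i.1 - i.2))‖ₑ ≤ ENNReal.ofReal C *
        (J a i.1 * G b i.2 * G c (k - i.1 - i.2) + G a i.1 * J b i.2 * G c (k - i.1 - i.2)
          + G a i.1 * G b i.2 * J c (k - i.1 - i.2)) := by
    rintro k ⟨p, q⟩
    have h1 := ENNReal.ofReal_le_ofReal (hσ k p q)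
    have h2 := hj p
    have h3 := hj q
    have h4 := hj (k - p - q)
    have h5 := hg0 p
    have h6 := hg0 q
    have h7 := hg0 (k - p - q)
    rw [ENNReal.ofReal_mul (norm_nonneg _), ENNReal.ofReal_mul hC,
      ENNReal.ofReal_add (by positivity) (by positivity),
      ENNReal.ofReal_add (by positivity) (by positivity), ENNReal.ofReal_mul (by positivity),
      ENNReal.ofReal_mul (by positivity), ENNReal.ofReal_mul (by positivity),
      ENNReal.ofReal_mul (by positivity), ENNReal.ofReal_mul (by positivity),
      ENNReal.ofReal_mul (by positivity), ofReal_norm] at h1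
    simp only [hJ, hG, enorm_mul]
    calc _ = ‖σ k p q‖ₑ * ENNReal.ofReal (jap k) * (‖a p‖ₑ * ‖b q‖ₑ * ‖c (k - p - q)‖ₑ) := by ring
      _ ≤ _ * (‖a p‖ₑ * ‖b q‖ₑ * ‖c (k - p - q)‖ₑ) := mul_le_mul_left h1 _
      _ = _ := by ring
  have hN : ∀ x, SeqH1 x → ∑' k, J x k ^ 2 = ENNReal.ofReal (seqNorm x) ^ 2 :=
    fun x hx => hx.tsum_enorm
  have hL : ∀ x, SeqH1 x → (∑' k, G x k) ^ 2
      ≤ ENNReal.ofReal S * ENNReal.ofReal (seqNorm x) ^ 2 := fun x hx => hg.tsum_enorm_sq_le hx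
  set D : ℝ≥0∞ := ENNReal.ofReal S ^ 2 * (ENNReal.ofReal (seqNorm a) ^ 2
    * ENNReal.ofReal (seqNorm b) ^ 2 * ENNReal.ofReal (seqNorm c) ^ 2) with hD
  have e1 : ∑' k : ℤ, (∑' i : ℤ × ℤ, J a i.1 * G b i.2 * G c (k - i.1 - i.2)) ^ 2 ≤ D := by
    refine (ennreal_young_left _ _ _).trans ?_
    rw [hN a ha]
    calc _ ≤ _ := mul_le_mul' (mul_le_mul_right (hL b hb) _) (hL c hc)
      _ = D := by rw [hD]; ring
  have e2 : ∑' k : ℤ, (∑' i : ℤ × ℤ, G a i.1 * J b i.2 * G c (k - i.1 - i.2)) ^ 2 ≤ D := by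
    refine (ennreal_young_mid _ _ _).trans ?_
    rw [hN b hb]
    calc _ ≤ _ := mul_le_mul' (mul_le_mul_right (hL a ha) _) (hL c hc)
      _ = D := by rw [hD]; ring
  have e3 : ∑' k : ℤ, (∑' i : ℤ × ℤ, G a i.1 * G b i.2 * J c (k - i.1 - i.2)) ^ 2 ≤ D := by
    refine (ennreal_young _ _ _).trans ?_
    rw [hN c hc]
    calc _ ≤ _ := mul_le_mul' (mul_le_mul_right (hL a ha) _) (hL b hb)
      _ = D := by rw [hD]; ring
  have hS := hg.sum_nonneg
  calc _ ≤ ∑' k : ℤ, (ENNReal.ofReal C *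
        ((∑' i : ℤ × ℤ, J a i.1 * G b i.2 * G c (k - i.1 - i.2))
        + (∑' i : ℤ × ℤ, G a i.1 * J b i.2 * G c (k - i.1 - i.2))
        + ∑' i : ℤ × ℤ, G a i.1 * G b i.2 * J c (k - i.1 - i.2))) ^ 2 := by
        refine ENNReal.tsum_le_tsum fun k => pow_le_pow_left' ?_ 2
        rw [← ENNReal.tsum_add, ← ENNReal.tsum_add, ← ENNReal.tsum_mul_left,
          ← ENNReal.tsum_mul_left]
        exact ENNReal.tsum_le_tsum fun i => key k i
    _ ≤ ∑' k : ℤ, ENNReal.ofReal C ^ 2 * (3 *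
        ((∑' i : ℤ × ℤ, J a i.1 * G b i.2 * G c (k - i.1 - i.2)) ^ 2
        + (∑' i : ℤ × ℤ, G a i.1 * J b i.2 * G c (k - i.1 - i.2)) ^ 2
        + (∑' i : ℤ × ℤ, G a i.1 * G b i.2 * J c (k - i.1 - i.2)) ^ 2)) := by
        refine ENNReal.tsum_le_tsum fun k => ?_
        rw [mul_pow]
        exact mul_le_mul_right (ennreal_add_three_sq_le _ _ _) _
    _ ≤ ENNReal.ofReal C ^ 2 * (3 * (D + D + D)) := by
        rw [ENNReal.tsum_mul_left, ENNReal.tsum_mul_left, ENNReal.tsum_add, ENNReal.tsum_add]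
        gcongr
    _ = _ := by
        have n1 := seqNorm_nonneg a
        have n2 := seqNorm_nonneg b
        have n3 := seqNorm_nonneg c
        rw [hD, ENNReal.ofReal_mul (by positivity), ENNReal.ofReal_mul (by positivity),
          ENNReal.ofReal_mul (by positivity), ENNReal.ofReal_mul (by positivity),
          ENNReal.ofReal_mul (by positivity)]
        rw [show ENNReal.ofReal 3 = 3 by simp]
        ring

lemma tri_summable (hg : IsWeight g S) (hC : 0 ≤ C) (hσ : SymbolBound g C σ)
    (ha : SeqH1 a) (hb : SeqH1 b) (hc : SeqH1 c) (k : ℤ) :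
    Summable fun i : ℤ × ℤ => σ k i.1 i.2 * (a i.1 * b i.2 * c (k - i.1 - i.2)) := by
  have h := ENNReal.ne_top_of_tsum_ne_top
    (ne_top_of_le_ne_top (by simp) (tri_enorm_bound hg hC hσ ha hb hc)) k
  have h1 : ∑' i : ℤ × ℤ, ‖σ k i.1 i.2 * (a i.1 * b i.2 * c (k - i.1 - i.2))‖ₑ ≠ ∞ := by
    intro h2
    rw [h2, ENNReal.mul_top (by simpa using jap_pos k)] at h
    simp at h
  refine Summable.of_norm ((ENNReal.summable_toReal h1).congr fun i => ?_)
  simp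

lemma tri_bound (hg : IsWeight g S) (hC : 0 ≤ C) (hσ : SymbolBound g C σ)
    (ha : SeqH1 a) (hb : SeqH1 b) (hc : SeqH1 c) :
    SeqH1 (tri σ a b c) ∧
      seqNorm (tri σ a b c) ≤ 3 * C * S * seqNorm a * seqNorm b * seqNorm c := by
  have n1 := seqNorm_nonneg a
  have n2 := seqNorm_nonneg b
  have n3 := seqNorm_nonneg c
  have hS := hg.sum_nonneg
  refine seqH1_of_tsum_le (by positivity) (le_trans ?_ (tri_enorm_bound hg hC hσ ha hb hc))
  refine ENNReal.tsum_le_tsum fun k => pow_le_pow_left' (mul_le_mul_right ?_ _) 2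
  exact enorm_tsum_le_tsum_enorm

lemma tri_sub (hg : IsWeight g S) (hC : 0 ≤ C) (hσ : SymbolBound g C σ) {a' b' c' : ℤ → ℂ}
    (ha : SeqH1 a) (hb : SeqH1 b) (hc : SeqH1 c) (ha' : SeqH1 a') (hb' : SeqH1 b')
    (hc' : SeqH1 c') :
    tri σ a b c - tri σ a' b' c'
      = tri σ (a - a') b c + tri σ a' (b - b') c + tri σ a' b' (c - c') := by
  funext k
  have s := fun x y z hx hy hz => tri_summable (a := x) (b := y) (c := z) hg hC hσ hx hy hz k
  change tri σ a b c k - tri σ a' b' c' k =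
    tri σ (a - a') b c k + tri σ a' (b - b') c k + tri σ a' b' (c - c') k
  unfold tri
  rw [← (s _ _ _ ha hb hc).tsum_sub (s _ _ _ ha' hb' hc'),
    ← (s _ _ _ (ha.sub ha') hb hc).tsum_add (s _ _ _ ha' (hb.sub hb') hc),
    ← ((s _ _ _ (ha.sub ha') hb hc).add (s _ _ _ ha' (hb.sub hb') hc)).tsum_add
      (s _ _ _ ha' hb' (hc.sub hc'))]
  refine tsum_congr fun i => ?_
  simp only [Pi.sub_apply]
  ring

lemma tri_sub_bound (hg : IsWeight g S) (hC : 0 ≤ C) (hσ : SymbolBound g C σ)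
    {a' b' c' : ℤ → ℂ} (ha : SeqH1 a) (hb : SeqH1 b) (hc : SeqH1 c) (ha' : SeqH1 a')
    (hb' : SeqH1 b') (hc' : SeqH1 c') {B d : ℝ} (hb1 : seqNorm b ≤ B) (hc1 : seqNorm c ≤ B)
    (ha1' : seqNorm a' ≤ B) (hb1' : seqNorm b' ≤ B) (hda : seqNorm (a - a') ≤ d)
    (hdb : seqNorm (b - b') ≤ d) (hdc : seqNorm (c - c') ≤ d) :
    seqNorm (tri σ a b c - tri σ a' b' c') ≤ 9 * C * S * B ^ 2 * d := by
  have hS := hg.sum_nonneg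
  have hB : 0 ≤ B := (seqNorm_nonneg _).trans hb1
  have hd : 0 ≤ d := (seqNorm_nonneg _).trans hda
  rw [tri_sub hg hC hσ ha hb hc ha' hb' hc']
  have t1 := tri_bound hg hC hσ (ha.sub ha') hb hc
  have t2 := tri_bound hg hC hσ ha' (hb.sub hb') hc
  have t3 := tri_bound hg hC hσ ha' hb' (hc.sub hc')
  have n := seqNorm_nonneg
  refine (seqNorm_add_le (t1.1.add t2.1) t3.1).trans ?_
  refine (add_le_add_left (seqNorm_add_le t1.1 t2.1) _).trans ?_
  have q1 : seqNorm (tri σ (a - a') b c) ≤ 3 * C * S * d * B * B := t1.2.trans (by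
    have := n b; have := n c; have := n (a - a'); gcongr)
  have q2 : seqNorm (tri σ a' (b - b') c) ≤ 3 * C * S * B * d * B := t2.2.trans (by
    have := n a'; have := n c; have := n (b - b'); gcongr)
  have q3 : seqNorm (tri σ a' b' (c - c')) ≤ 3 * C * S * B * B * d := t3.2.trans (by
    have := n a'; have := n b'; have := n (c - c'); gcongr)
  linarith

end

/-- The series is `∑ ⟨k⟩^{-(2-2θ)}`, convergent exactly when `2 - 2θ > 1`. This is the only source
of the restriction `θ < 1/2`. -/
lemma isWeight_rpow {θ : ℝ} (h1 : θ < 1 / 2) :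
    IsWeight (fun k => jap k ^ θ) (∑' k : ℤ, (jap k ^ θ / jap k) ^ 2) := by
  refine ⟨fun k => Real.rpow_nonneg (jap_pos k).le _, Summable.hasSum ?_⟩
  have hs := (Real.summable_abs_int_rpow (b := 2 - 2 * θ) (by linarith)).add
    (summable_of_ne_finset_zero (f := fun k : ℤ => if k = 0 then (1 : ℝ) else 0) (s := {0})
      (by intro b hb; simp at hb; simp [hb]))
  refine Summable.of_nonneg_of_le (fun k => sq_nonneg _) (fun k => ?_) hs
  have h0 : (jap k ^ θ / jap k) ^ 2 = jap k ^ (-(2 - 2 * θ)) := by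
    rw [← Real.rpow_sub_one (jap_pos k).ne', ← Real.rpow_natCast, ← Real.rpow_mul (jap_pos k).le]
    congr 1
    push_cast
    ring
  rw [h0]
  by_cases hk : k = 0
  · subst hk
    have : jap 0 = 1 := by simp [jap]
    rw [this]
    simp
    positivity
  · rw [if_neg hk, add_zero]
    have : 0 < |(k : ℝ)| := abs_pos.2 (by exact_mod_cast hk)
    exact Real.rpow_le_rpow_of_nonpos this (abs_le_jap k) (by linarith)

lemma exists_isWeight_one : ∃ S : ℝ, IsWeight (fun _ => 1) S := by
  have := isWeight_rpow (θ := 0) (by norm_num)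
  simp only [Real.rpow_zero] at this
  exact ⟨_, this⟩

/-! ### Fourier coefficients of square integrable functions -/

lemma coeFn_toLp_coeff {f : Torus → ℂ} (hf : MemLp f 2 normMeasure) :
    fourierCoeff (hf.toLp f : Torus → ℂ) = fourierCoeff f :=
  fourierCoeff_congr_ae hf.coeFn_toLp

lemma summable_sq_coeff {f : Torus → ℂ} (hf : MemLp f 2 normMeasure) :
    Summable fun k => ‖coeff f k‖ ^ 2 := by
  have := (hasSum_sq_fourierCoeff (hf.toLp f)).summable
  rwa [coeFn_toLp_coeff hf] at this

lemma exists_memLp_coeff_eq {c : ℤ → ℂ} (hc : Summable fun k => ‖c k‖ ^ 2) :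
    ∃ g : Torus → ℂ, MemLp g 2 normMeasure ∧ ∀ k, coeff g k = c k := by
  have hm : Memℓp c 2 := by
    rw [memℓp_gen_iff (by norm_num)]
    simpa only [ENNReal.toReal_ofNat, Real.rpow_two] using hc
  let x : lp (fun _ : ℤ => ℂ) 2 := ⟨c, hm⟩
  let g := (fourierBasis (T := 2 * Real.pi)).repr.symm x
  refine ⟨g, Lp.memLp g, fun k => ?_⟩
  rw [coeff, ← fourierBasis_repr, LinearIsometryEquiv.apply_symm_apply]

lemma fourierMul_spec {m : ℤ → ℂ} {f : Torus → ℂ} (h : Summable fun k => ‖m k * coeff f k‖ ^ 2) :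
    MemLp (fourierMul m f) 2 normMeasure ∧ ∀ k, coeff (fourierMul m f) k = m k * coeff f k := by
  have h' := exists_memLp_coeff_eq h
  rw [fourierMul, dif_pos h']
  exact h'.choose_spec

lemma fourierMul_spec_of_bdd {m : ℤ → ℂ} {f : Torus → ℂ} {C : ℝ} (hf : MemLp f 2 normMeasure)
    (hm : ∀ k, ‖m k‖ ≤ C) :
    MemLp (fourierMul m f) 2 normMeasure ∧ ∀ k, coeff (fourierMul m f) k = m k * coeff f k := by
  refine fourierMul_spec (Summable.of_nonneg_of_le (fun k => by positivity) (fun k => ?_)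
    ((summable_sq_coeff hf).mul_left (C ^ 2)))
  rw [norm_mul, mul_pow]
  gcongr
  exact hm k

lemma MemH1.seqH1 {f : Torus → ℂ} (hf : MemH1 f) : SeqH1 (coeff f) := hf.2

lemma h1Norm_eq (f : Torus → ℂ) : h1Norm f = √(2 * Real.pi) * seqNorm (coeff f) := by
  rw [h1Norm, seqNorm, Real.sqrt_mul (by positivity)]

lemma MemH1.integrable {f : Torus → ℂ} (hf : MemH1 f) : Integrable f normMeasure :=
  hf.1.integrable (by norm_num)

lemma coeff_fourierMul {m : ℤ → ℂ} {f : Torus → ℂ} {C : ℝ} (hf : MemH1 f)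
    (hm : ∀ k, ‖m k‖ ≤ C) (k : ℤ) : coeff (fourierMul m f) k = m k * coeff f k :=
  (fourierMul_spec_of_bdd hf.1 hm).2 k

lemma memH1_fourierMul {m : ℤ → ℂ} {f : Torus → ℂ} {C : ℝ} (hf : MemH1 f)
    (hm : ∀ k, ‖m k‖ ≤ C) : MemH1 (fourierMul m f) := by
  refine ⟨(fourierMul_spec_of_bdd hf.1 hm).1, hf.seqH1.of_le C fun k => ?_⟩
  rw [coeff_fourierMul hf hm, norm_mul]
  exact mul_le_mul_of_nonneg_right (hm k) (norm_nonneg _)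

lemma coeff_add {f g : Torus → ℂ} (hf : MemH1 f) (hg : MemH1 g) :
    coeff (f + g) = coeff f + coeff g :=
  fourierCoeff.add hf.integrable hg.integrable

lemma coeff_const_mul (f : Torus → ℂ) (c : ℂ) : coeff (fun x => c * f x) = fun k => c * coeff f k :=
  funext fun k => fourierCoeff.const_mul f c k

lemma MemH1.add {f g : Torus → ℂ} (hf : MemH1 f) (hg : MemH1 g) : MemH1 (f + g) := by
  refine ⟨hf.1.add hg.1, ?_⟩
  change SeqH1 _
  rw [coeff_add hf hg]
  exact hf.seqH1.add hg.seqH1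

lemma MemH1.const_mul {f : Torus → ℂ} (hf : MemH1 f) (c : ℂ) : MemH1 (fun x => c * f x) := by
  refine ⟨hf.1.const_mul c, ?_⟩
  change SeqH1 _
  rw [coeff_const_mul]
  exact hf.seqH1.of_le ‖c‖ fun k => (norm_mul _ _).le

lemma MemH1.neg {f : Torus → ℂ} (hf : MemH1 f) : MemH1 (-f) := by
  convert hf.const_mul (-1) using 1
  funext x
  simp

lemma coeff_neg (f : Torus → ℂ) : coeff (-f) = -coeff f := by
  convert coeff_const_mul f (-1) using 1
  · congr 1; funext x; simp
  · funext k; simp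

lemma MemH1.sub {f g : Torus → ℂ} (hf : MemH1 f) (hg : MemH1 g) : MemH1 (f - g) := by
  rw [sub_eq_add_neg]; exact hf.add hg.neg

lemma coeff_sub {f g : Torus → ℂ} (hf : MemH1 f) (hg : MemH1 g) :
    coeff (f - g) = coeff f - coeff g := by
  rw [sub_eq_add_neg, coeff_add hf hg.neg, coeff_neg, sub_eq_add_neg]

lemma coeff_const (c : ℂ) (k : ℤ) : coeff (fun _ => c) k = if k = 0 then c else 0 := by
  have h : (fun _ : Torus => c) = fun x => c * fourier (T := 2 * Real.pi) 0 x := by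
    funext x; simp
  rw [h, coeff_const_mul]
  simp only [coeff, fourierCoeff_fourier, Pi.single_apply]
  simp

lemma memH1_const (c : ℂ) : MemH1 (fun _ => c) := by
  refine ⟨memLp_const c, summable_of_ne_finset_zero (s := {0}) fun k hk => ?_⟩
  rw [coeff_const, if_neg (by simpa using hk)]
  simp

lemma zeroMode_eq_coeff (f : Torus → ℂ) : zeroMode f = coeff f 0 := by
  simp [zeroMode, coeff, fourierCoeff]

/-- The sequence `k ↦ conj a₋ₖ` of Fourier coefficients of the complex conjugate. -/
def refl (a : ℤ → ℂ) (k : ℤ) : ℂ := conj (a (-k))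

lemma SeqH1.refl {a : ℤ → ℂ} (ha : SeqH1 a) : SeqH1 (refl a) := by
  have := (Equiv.neg ℤ).summable_iff.2 ha
  refine this.congr fun k => ?_
  simp [NLSTorus.refl]

lemma seqNorm_refl (a : ℤ → ℂ) : seqNorm (refl a) = seqNorm a := by
  unfold seqNorm
  congr 1
  rw [← (Equiv.neg ℤ).tsum_eq (fun k : ℤ => (1 + (k : ℝ) ^ 2) * ‖a k‖ ^ 2)]
  refine tsum_congr fun k => ?_
  simp [refl]

lemma refl_sub (a b : ℤ → ℂ) : refl a - refl b = refl (a - b) := by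
  funext k; simp [refl]

lemma coeff_cj (f : Torus → ℂ) : coeff (cj f) = refl (coeff f) := by
  funext k
  simp only [coeff, fourierCoeff, refl, cj]
  rw [← integral_conj]
  refine integral_congr_ae (Eventually.of_forall fun x => ?_)
  simp

lemma MemH1.cj {f : Torus → ℂ} (hf : MemH1 f) : MemH1 (cj f) := by
  refine ⟨?_, ?_⟩
  · refine hf.1.of_le (Complex.continuous_conj.comp_aestronglyMeasurable hf.1.1)
      (Eventually.of_forall fun x => ?_)
    simp [NLSTorus.cj]
  · change SeqH1 _
    rw [coeff_cj]
    exact hf.seqH1.refl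

lemma absSq_eq (f : Torus → ℂ) : absSq f = cj f * f := by
  funext x
  simp [absSq, cj, Complex.conj_mul']

/-! ### Products -/

lemma SeqH1.summable_norm {a : ℤ → ℂ} (ha : SeqH1 a) : Summable fun k => ‖a k‖ := by
  obtain ⟨S, hS⟩ := exists_isWeight_one
  have h := hS.tsum_enorm_sq_le ha
  have h1 : ∑' k, ‖a k‖ₑ ≠ ∞ := by
    intro h2
    simp only [ENNReal.ofReal_one, one_mul, h2] at h
    exact absurd h (by simp [ENNReal.mul_eq_top])
  exact (ENNReal.summable_toReal h1).congr fun k => by simp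

/-- The Fourier series converges absolutely, hence uniformly, to a continuous representative.
Boundedness is what keeps products in `L²`, where `fourierMul` is controlled. -/
lemma MemH1.memLp_top {f : Torus → ℂ} (hf : MemH1 f) : MemLp f ∞ normMeasure := by
  have hs : Summable fun k => coeff f k • fourier (T := 2 * Real.pi) k := by
    refine Summable.of_norm (hf.seqH1.summable_norm.congr fun k => ?_)
    rw [norm_smul, fourier_norm, mul_one]
  set F := ∑' k, coeff f k • fourier (T := 2 * Real.pi) k with hF
  have h1 := hs.hasSum.mapL (ContinuousMap.toLp (E := ℂ) 2 normMeasure ℂ)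
  have h2 := hasSum_fourier_series_L2 (hf.1.toLp f)
  rw [coeFn_toLp_coeff hf.1] at h2
  have h3 : ContinuousMap.toLp (E := ℂ) 2 normMeasure ℂ F = hf.1.toLp f := by
    refine HasSum.unique h1 ?_
    simpa using h2
  have h4 : (F : Torus → ℂ) =ᵐ[normMeasure] f := by
    refine (ContinuousMap.coeFn_toLp (p := 2) (𝕜 := ℂ) normMeasure F).symm.trans ?_
    rw [h3]
    exact hf.1.coeFn_toLp
  refine (MemLp.ae_eq h4 ?_)
  exact memLp_top_of_bound F.continuous.aestronglyMeasurable ‖F‖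
    (Eventually.of_forall fun x => F.norm_coe_le_norm x)

/-- Parseval's identity for the inner product of `e^{ikx} f̄` with `g`. -/
lemma hasSum_coeff_mul {f g : Torus → ℂ} (hf : MemLp f 2 normMeasure)
    (hg : MemLp g 2 normMeasure) (k : ℤ) :
    HasSum (fun j => coeff f (k - j) * coeff g j) (coeff (f * g) k) := by
  set x : Torus → ℂ := fun t => fourier k t * conj (f t) with hx
  have hxm : MemLp x 2 normMeasure := by
    refine hf.of_le ((fourier k).continuous.aestronglyMeasurable.mul
      (Complex.continuous_conj.comp_aestronglyMeasurable hf.1)) (Eventually.of_forall fun t => ?_)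
    simp only [hx, norm_mul, fourier_apply, Circle.norm_coe, one_mul, RCLike.norm_conj, le_refl]
  have h := HilbertBasis.hasSum_inner_mul_inner (fourierBasis (T := 2 * Real.pi))
    (hxm.toLp x) (hg.toLp g)
  have e1 : inner ℂ (hxm.toLp x) (hg.toLp g) = coeff (f * g) k := by
    rw [L2.inner_def]
    refine integral_congr_ae ?_
    filter_upwards [hxm.coeFn_toLp, hg.coeFn_toLp] with t h1 h2
    rw [h1, h2]
    simp only [RCLike.inner_apply, hx, map_mul, Complex.conj_conj, Pi.mul_apply, smul_eq_mul,
      fourier_neg]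
    ring
  have e2 : ∀ j, inner ℂ (fourierBasis (T := 2 * Real.pi) j) (hg.toLp g) = coeff g j := fun j => by
    rw [← HilbertBasis.repr_apply_apply, fourierBasis_repr, coeFn_toLp_coeff]
  have e3 : ∀ j, inner ℂ (hxm.toLp x) (fourierBasis (T := 2 * Real.pi) j) = coeff f (k - j) :=
      fun j => by
    rw [← inner_conj_symm, ← HilbertBasis.repr_apply_apply, fourierBasis_repr, coeFn_toLp_coeff]
    simp only [coeff, fourierCoeff]
    rw [← integral_conj]
    refine integral_congr_ae (Eventually.of_forall fun t => ?_)
    simp only [hx, smul_eq_mul, map_mul, Complex.conj_conj, ← fourier_neg, neg_neg]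
    rw [show -(k - j) = j + -k by ring, fourier_add]
    ring
  simpa only [e1, e2, e3] using h

lemma coeff_mul {f g : Torus → ℂ} (hf : MemLp f 2 normMeasure)
    (hg : MemLp g 2 normMeasure) (k : ℤ) :
    coeff (f * g) k = ∑' j, coeff f j * coeff g (k - j) := by
  rw [mul_comm f g, ← (hasSum_coeff_mul hg hf k).tsum_eq]
  exact tsum_congr fun j => mul_comm _ _

lemma jap_le_sum (k p q : ℤ) : jap k ≤ jap p + jap q + jap (k - p - q) := by
  calc jap k = jap (p + q + (k - p - q)) := by congr 1; ring
    _ ≤ _ := (jap_add_le _ _).trans (add_le_add_left (jap_add_le _ _) _)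

lemma symbolBound_of_bdd {σ : ℤ → ℤ → ℤ → ℂ} {C : ℝ} (h : ∀ k p q, ‖σ k p q‖ ≤ C) :
    SymbolBound (fun _ => 1) C σ := by
  intro k p q
  simp only [mul_one, one_mul]
  exact mul_le_mul (h k p q) (jap_le_sum k p q) (jap_pos k).le ((norm_nonneg _).trans (h k p q))

section

variable {σ σ' : ℤ → ℤ → ℤ → ℂ} {a b c : ℤ → ℂ}

lemma tri_summable_of_bdd {C : ℝ} (h : ∀ k p q, ‖σ k p q‖ ≤ C) (ha : SeqH1 a) (hb : SeqH1 b)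
    (hc : SeqH1 c) (k : ℤ) :
    Summable fun i : ℤ × ℤ => σ k i.1 i.2 * (a i.1 * b i.2 * c (k - i.1 - i.2)) := by
  obtain ⟨S, hS⟩ := exists_isWeight_one
  exact tri_summable hS ((norm_nonneg _).trans (h 0 0 0)) (symbolBound_of_bdd h) ha hb hc k

lemma seqH1_tri_of_bdd {C : ℝ} (h : ∀ k p q, ‖σ k p q‖ ≤ C) (ha : SeqH1 a) (hb : SeqH1 b)
    (hc : SeqH1 c) : SeqH1 (tri σ a b c) := by
  obtain ⟨S, hS⟩ := exists_isWeight_one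
  exact (tri_bound hS ((norm_nonneg _).trans (h 0 0 0)) (symbolBound_of_bdd h) ha hb hc).1

lemma tri_symbol_mul (m : ℤ → ℂ) (k : ℤ) :
    tri (fun k p q => m k * σ k p q) a b c k = m k * tri σ a b c k := by
  simp only [tri, mul_assoc]
  exact tsum_mul_left

lemma tri_congr {a' b' c' : ℤ → ℂ} {k : ℤ}
    (h : ∀ p q, σ k p q * (a p * b q * c (k - p - q)) =
      σ' k p q * (a' p * b' q * c' (k - p - q))) : tri σ a b c k = tri σ' a' b' c' k :=
  tsum_congr fun i => h i.1 i.2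

/-- A product of three factors with a multiplier acting on an inner pair can be bracketed in two
ways: here the multiplier sees `q + r = k - p`, in `tsum_eq_tri_right` it sees `p + q`. The terms of
the scheme use both. -/
lemma tsum_eq_tri_left {h : ℤ → ℂ} {C : ℝ} (hh : ∀ k, ‖h k‖ ≤ C) (ha : SeqH1 a)
    (hb : SeqH1 b) (hc : SeqH1 c) (k : ℤ) :
    ∑' p, a p * (h (k - p) * ∑' q, b q * c (k - p - q))
      = tri (fun k p _ => h (k - p)) a b c k := by
  have hs := tri_summable_of_bdd (σ := fun k p _ => h (k - p)) (fun k p _ => hh (k - p))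
    ha hb hc k
  rw [tri, hs.tsum_prod]
  refine tsum_congr fun p => ?_
  rw [← tsum_mul_left, ← tsum_mul_left]
  exact tsum_congr fun q => by ring

lemma tsum_eq_tri_right {h : ℤ → ℂ} {C : ℝ} (hh : ∀ k, ‖h k‖ ≤ C) (ha : SeqH1 a)
    (hb : SeqH1 b) (hc : SeqH1 c) (k : ℤ) :
    ∑' m, (h m * ∑' p, a p * b (m - p)) * c (k - m)
      = tri (fun _ p q => h (p + q)) a b c k := by
  have hs := tri_summable_of_bdd (σ := fun _ p q => h (p + q)) (fun k p q => hh (p + q))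
    ha hb hc k
  let e : ℤ × ℤ ≃ ℤ × ℤ :=
    ⟨fun i => (i.2, i.1 - i.2), fun i => (i.1 + i.2, i.1), fun i => by ext <;> simp,
      fun i => by ext <;> simp⟩
  have hs' := e.summable_iff.2 hs
  rw [tri, ← e.tsum_eq]
  refine Eq.trans ?_ hs'.tsum_prod.symm
  refine tsum_congr fun m => ?_
  rw [← tsum_mul_left, ← tsum_mul_right]
  refine tsum_congr fun p => ?_
  simp only [e, Function.comp, Equiv.coe_fn_mk]
  rw [show p + (m - p) = m by ring, show k - p - (m - p) = k - m by ring]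
  ring

end

lemma seqH1_single : SeqH1 (Pi.single 0 1) :=
  summable_of_ne_finset_zero (s := {0}) fun k hk => by
    simp [show k ≠ 0 by simpa using hk]

/-- A convolution is a trilinear form whose first entry is the unit mass at `0`, so the algebra
property follows from the trilinear bound. -/
lemma seqH1_conv {a b : ℤ → ℂ} (ha : SeqH1 a) (hb : SeqH1 b) :
    SeqH1 (fun k => ∑' j, a j * b (k - j)) := by
  have h := seqH1_tri_of_bdd (σ := fun _ _ _ => 1) (C := 1) (by simp) seqH1_single ha hb
  convert h using 1
  funext k
  have h1 := tsum_eq_tri_left (h := fun _ => 1) (C := 1) (by simp) seqH1_single ha hb k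
  have h2 : ∀ p ≠ 0, (Pi.single 0 1 : ℤ → ℂ) p * (1 * ∑' q, a q * b (k - p - q)) = 0 :=
    fun p hp => by rw [Pi.single_eq_of_ne hp, zero_mul]
  rw [← h1, tsum_eq_single 0 h2]
  simp

lemma MemH1.mul {f g : Torus → ℂ} (hf : MemH1 f) (hg : MemH1 g) : MemH1 (f * g) := by
  refine ⟨hg.1.mul hf.memLp_top, ?_⟩
  change SeqH1 _
  have : coeff (f * g) = _ := funext fun k => coeff_mul hf.1 hg.1 k
  rw [this]
  exact seqH1_conv hf.seqH1 hg.seqH1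

lemma MemH1.absSq {f : Torus → ℂ} (hf : MemH1 f) : MemH1 (absSq f) := by
  rw [absSq_eq]; exact hf.cj.mul hf

lemma coeff_absSq_mul {f : Torus → ℂ} (hf : MemH1 f) (k : ℤ) :
    coeff (absSq f * f) k
      = tri (fun _ _ _ => 1) (refl (coeff f)) (coeff f) (coeff f) k := by
  rw [absSq_eq, mul_assoc, coeff_mul hf.cj.1 (hf.mul hf).1,
    ← tsum_eq_tri_left (h := fun _ => 1) (C := 1) (by simp) hf.seqH1.refl hf.seqH1 hf.seqH1]
  refine tsum_congr fun p => ?_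
  rw [coeff_cj, one_mul, coeff_mul hf.1 hf.1]

/-! ### Mass and momentum -/

/-- The mass in terms of Fourier coefficients. -/
def seqMass (a : ℤ → ℂ) : ℝ := ∑' k, ‖a k‖ ^ 2

/-- The momentum in terms of Fourier coefficients, up to the factor `-i`. -/
def seqMom (a : ℤ → ℂ) : ℝ := ∑' k : ℤ, (k : ℝ) * ‖a k‖ ^ 2

lemma mass_eq {f : Torus → ℂ} (hf : MemH1 f) : mass f = seqMass (coeff f) := by
  rw [mass, zeroMode_eq_coeff, absSq_eq, mul_comm, coeff_mul hf.1 hf.cj.1, seqMass,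
    Complex.ofReal_tsum]
  refine tsum_congr fun k => ?_
  rw [coeff_cj, refl, zero_sub, neg_neg, Complex.mul_conj']
  push_cast
  rfl

lemma norm_invDerivSymbol_le (k : ℤ) : ‖invDerivSymbol k‖ ≤ 1 := by
  unfold invDerivSymbol
  split_ifs with h
  · simp
  · rw [norm_inv, norm_mul, Complex.norm_I, one_mul]
    refine inv_le_one_of_one_le₀ ?_
    rw [Complex.norm_intCast]
    exact_mod_cast Int.one_le_abs h

lemma momentum_eq {f : Torus → ℂ} (hf : MemH1 f) :
    momentum f = -Complex.I * seqMom (coeff f) := by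
  have hd := fourierMul_spec (m := fun k => Complex.I * (k : ℂ)) (f := cj f) (by
    refine Summable.of_nonneg_of_le (fun k => by positivity) (fun k => ?_) hf.cj.2
    rw [norm_mul, norm_mul, Complex.norm_I, one_mul, mul_pow, Complex.norm_intCast, sq_abs]
    gcongr
    linarith)
  rw [momentum, deriv1, zeroMode_eq_coeff, coeff_mul hf.1 hd.1, seqMom, Complex.ofReal_tsum,
    ← tsum_mul_left]
  refine tsum_congr fun k => ?_
  rw [hd.2, coeff_cj, refl]
  simp only [zero_sub, neg_neg]
  push_cast
  rw [← Complex.mul_conj']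
  ring

/-! ### The numerical step -/

lemma norm_exp_of_re_zero {z : ℂ} (h : z.re = 0) : ‖Complex.exp z‖ = 1 := by
  rw [Complex.norm_exp, h, Real.exp_zero]

lemma norm_exp_mul_I_int (s : ℝ) (k : ℤ) : ‖Complex.exp (Complex.I * s * k)‖ = 1 :=
  norm_exp_of_re_zero (by simp)

lemma norm_freeSymbol (s : ℝ) (k : ℤ) :
    ‖Complex.exp (-Complex.I * (s : ℂ) * (k : ℂ) ^ 2)‖ = 1 :=
  norm_exp_of_re_zero (by
    rw [show -Complex.I * (s : ℂ) * (k : ℂ) ^ 2 = ((-(s * (k : ℝ) ^ 2) : ℝ) : ℂ) * Complex.I by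
      push_cast; ring]
    rw [Complex.re_ofReal_mul, Complex.I_re, mul_zero])

lemma coeff_freeProp {f : Torus → ℂ} (s : ℝ) (hf : MemH1 f) (k : ℤ) :
    coeff (freeProp s f) k = Complex.exp (-Complex.I * (s : ℂ) * (k : ℂ) ^ 2) * coeff f k :=
  coeff_fourierMul hf (fun k => (norm_freeSymbol s k).le) k

lemma memH1_freeProp {f : Torus → ℂ} (s : ℝ) (hf : MemH1 f) : MemH1 (freeProp s f) :=
  memH1_fourierMul hf (fun k => (norm_freeSymbol s k).le)

lemma coeff_invDeriv {f : Torus → ℂ} (hf : MemH1 f) (k : ℤ) :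
    coeff (invDeriv f) k = invDerivSymbol k * coeff f k :=
  coeff_fourierMul hf norm_invDerivSymbol_le k

lemma memH1_invDeriv {f : Torus → ℂ} (hf : MemH1 f) : MemH1 (invDeriv f) :=
  memH1_fourierMul hf norm_invDerivSymbol_le

lemma norm_invDerivSymbol_sq_le (k : ℤ) : ‖invDerivSymbol k ^ 2‖ ≤ 1 := by
  rw [norm_pow]
  exact pow_le_one₀ (norm_nonneg _) (norm_invDerivSymbol_le k)

lemma coeff_invDeriv2 {f : Torus → ℂ} (hf : MemH1 f) (k : ℤ) :
    coeff (invDeriv2 f) k = invDerivSymbol k ^ 2 * coeff f k :=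
  coeff_fourierMul hf norm_invDerivSymbol_sq_le k

lemma memH1_invDeriv2 {f : Torus → ℂ} (hf : MemH1 f) : MemH1 (invDeriv2 f) :=
  memH1_fourierMul hf norm_invDerivSymbol_sq_le

/-- The phase of the linear part of the scheme, without the free propagator, for mass `M` and
momentum `-iP`. -/
def resonantPhase (M P : ℝ) (k : ℤ) : ℝ := 2 * M + if k = 0 then 0 else -2 * P / k

/-- The symbol of the trilinear part of the scheme. -/
def stepSymbol (τ : ℝ) (k p q : ℤ) : ℂ :=
  (if k = 0 then -Complex.I * τ else 0)
    + (-(1 / 2) * invDerivSymbol k ^ 2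
      * (Complex.exp (Complex.I * τ * ((2 * k * p : ℤ) : ℂ)) - 1)
    + invDerivSymbol k * (invDerivSymbol (p + q)
      * (Complex.exp (Complex.I * τ * ((2 * (p + q) * (k - q) : ℤ) : ℂ)) - 1)))

/-- The momentum is purely imaginary, `-iP`, and so is the symbol of `∂ₓ⁻¹`; hence the extra phase
is real and the linear part is unitary. -/
lemma linearSymbol_eq (τ M P : ℝ) (k : ℤ) :
    Complex.exp (Complex.I * (τ : ℂ) * (-2 * (M : ℂ) - 2 * (-Complex.I * (P : ℂ))
      * invDerivSymbol k - (k : ℂ) ^ 2))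
      = Complex.exp (-Complex.I * (τ : ℂ) * (k : ℂ) ^ 2)
        * Complex.exp (-Complex.I * ((τ * resonantPhase M P k : ℝ) : ℂ)) := by
  rw [← Complex.exp_add]
  congr 1
  unfold invDerivSymbol resonantPhase
  split_ifs with h
  · push_cast
    ring
  · have : (k : ℂ) ≠ 0 := by exact_mod_cast h
    push_cast
    field_simp
    ring

/-- Each operator in the scheme is a multiplier. After factoring out `e^{-iτk²}`, the `∂ₓ⁻²` terms
carry the phase `2kp` because `p² - (k-p)² + k² = 2kp`, and the `∂ₓ⁻¹` terms carry the full phase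
`2(p+q)(k-q)`. -/
lemma memH1_step {f : Torus → ℂ} (τ M P : ℝ) (hf : MemH1 f) :
    MemH1 (step τ M (-Complex.I * P) f) ∧ ∀ k, coeff (step τ M (-Complex.I * P) f) k =
      Complex.exp (-Complex.I * (τ : ℂ) * (k : ℂ) ^ 2) *
      (Complex.exp (-Complex.I * ((τ * resonantPhase M P k : ℝ) : ℂ)) * coeff f k
        + (if k = 0 then 2 * Complex.I * τ * M * coeff f 0 else 0)
        + tri (stepSymbol τ) (refl (coeff f)) (coeff f) (coeff f) k) := by
  have hlin : ∀ k : ℤ, ‖Complex.exp (Complex.I * (τ : ℂ) * (-2 * (M : ℂ)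
      - 2 * (-Complex.I * (P : ℂ)) * invDerivSymbol k - (k : ℂ) ^ 2))‖ ≤ 1 := fun k => by
    rw [linearSymbol_eq, norm_mul, norm_freeSymbol, one_mul]
    refine (norm_exp_of_re_zero ?_).le
    simp
  set f1 := linearPart τ M (-Complex.I * P) f with hf1
  set c2 : ℂ := Complex.I * (τ : ℂ) * zeroMode (absSq f * f) with hc2
  set c3 : ℂ := 2 * Complex.I * (τ : ℂ) * M * zeroMode f with hc3
  set f4 := invDeriv2 (freeProp (-τ) (cj f) * freeProp τ (f * f)) with hf4
  set f5 := freeProp τ (invDeriv2 (absSq f * f)) with hf5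
  set f6 := invDeriv (freeProp τ f * invDeriv (absSq (freeProp τ f))) with hf6
  set f7 := freeProp τ (invDeriv (f * invDeriv (absSq f))) with hf7
  have hstep : step τ M (-Complex.I * P) f = f1 - (fun _ => c2) + (fun _ => c3)
      - (fun x => (1 / 2 : ℂ) * f4 x) + (fun x => (1 / 2 : ℂ) * f5 x) + f6 - f7 := rfl
  have ff := hf.mul hf
  have m1 : MemH1 f1 := memH1_fourierMul hf hlin
  have m4' := (memH1_freeProp (-τ) hf.cj).mul (memH1_freeProp τ ff)
  have m4 : MemH1 f4 := memH1_invDeriv2 m4'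
  have m5' := memH1_invDeriv2 (hf.absSq.mul hf)
  have m5 : MemH1 f5 := memH1_freeProp τ m5'
  have m6a := (memH1_freeProp τ hf).absSq
  have m6b := memH1_invDeriv m6a
  have m6' := (memH1_freeProp τ hf).mul m6b
  have m6 : MemH1 f6 := memH1_invDeriv m6'
  have m7b := memH1_invDeriv hf.absSq
  have m7' := hf.mul m7b
  have m7 : MemH1 f7 := memH1_freeProp τ (memH1_invDeriv m7')
  have n2 := m1.sub (memH1_const c2)
  have n3 := n2.add (memH1_const c3)
  have n4 := n3.sub (m4.const_mul (1 / 2))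
  have n5 := n4.add (m5.const_mul (1 / 2))
  have n6 := n5.add m6
  refine ⟨by rw [hstep]; exact n6.sub m7, fun k => ?_⟩
  rw [hstep, coeff_sub n6 m7, coeff_add n5 m6, coeff_add n4 (m5.const_mul (1 / 2)),
    coeff_sub n3 (m4.const_mul (1 / 2)), coeff_add n2 (memH1_const c3),
    coeff_sub m1 (memH1_const c2), coeff_const_mul f4, coeff_const_mul f5]
  simp only [Pi.add_apply, Pi.sub_apply, coeff_const]
  set a := coeff f with ha
  have sa : SeqH1 a := hf.seqH1
  set E : ℤ → ℂ := fun k => Complex.exp (-Complex.I * (τ : ℂ) * (k : ℂ) ^ 2) with hE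
  have hEE : ∀ k, ‖E k‖ ≤ 1 := fun k => (norm_freeSymbol τ k).le
  have e1 : coeff f1 k = E k * Complex.exp (-Complex.I * ((τ * resonantPhase M P k : ℝ) : ℂ))
      * a k := by
    rw [hf1, linearPart, coeff_fourierMul hf hlin, linearSymbol_eq]
  have e2 : zeroMode (absSq f * f) = tri (fun _ _ _ => 1) (refl a) a a 0 := by
    rw [zeroMode_eq_coeff, coeff_absSq_mul hf]
  have hEs : SeqH1 (fun k => E k * a k) := sa.of_le 1 fun k => by
    rw [norm_mul]; exact mul_le_mul_of_nonneg_right (hEE k) (norm_nonneg _)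
  have hcjE : coeff (freeProp (-τ) (cj f)) = refl (fun k => E k * a k) := by
    funext p
    rw [coeff_freeProp _ hf.cj, coeff_cj, refl, refl, map_mul]
    congr 1
    simp only [hE]
    rw [← Complex.exp_conj]
    congr 1
    simp
  have hinvE : ∀ p, (refl (fun k => E k * a k)) p = (E p)⁻¹ * refl a p := fun p => by
    simp only [refl, map_mul]
    congr 1
    simp only [hE]
    rw [← Complex.exp_conj, ← Complex.exp_neg]
    congr 1
    simp
  have e4 : coeff f4 k = E k * (invDerivSymbol k ^ 2 *
      tri (fun k p _ => Complex.exp (Complex.I * τ * ((2 * k * p : ℤ) : ℂ))) (refl a) a a k) := by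
    rw [hf4, coeff_invDeriv2 m4', coeff_mul (memH1_freeProp (-τ) hf.cj).1 (memH1_freeProp τ ff).1,
      hcjE]
    have h1 := tsum_eq_tri_left hEE hEs.refl sa sa k
    have h2 : ∀ p, coeff (freeProp τ (f * f)) (k - p)
        = E (k - p) * ∑' q, a q * a (k - p - q) := fun p => by
      rw [coeff_freeProp τ ff, coeff_mul hf.1 hf.1]
    simp only [h2]
    rw [h1, mul_left_comm]
    congr 1
    rw [← tri_symbol_mul (m := E)]
    refine tri_congr fun p q => ?_
    rw [hinvE]
    have h3 : E (k - p) * (E p)⁻¹ = E k * Complex.exp (Complex.I * τ * ((2 * k * p : ℤ) : ℂ)) := by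
      simp only [hE]
      rw [← Complex.exp_neg, ← Complex.exp_add, ← Complex.exp_add]
      congr 1
      push_cast
      ring
    linear_combination (refl a p * a q * a (k - p - q)) * h3
  have e5 : coeff f5 k = E k * (invDerivSymbol k ^ 2 * tri (fun _ _ _ => 1) (refl a) a a k) := by
    rw [hf5, coeff_freeProp τ m5', coeff_invDeriv2 (hf.absSq.mul hf), coeff_absSq_mul hf]
  have e6 : coeff f6 k = E k * (invDerivSymbol k * tri (fun k p q => invDerivSymbol (p + q)
      * Complex.exp (Complex.I * τ * ((2 * (p + q) * (k - q) : ℤ) : ℂ))) (refl a) a a k) := by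
    have hF : coeff (freeProp τ f) = fun k => E k * a k := funext (coeff_freeProp τ hf)
    rw [hf6, coeff_invDeriv m6', mul_comm (freeProp τ f), coeff_mul m6b.1 (memH1_freeProp τ hf).1]
    have h2 : ∀ m, coeff (invDeriv (absSq (freeProp τ f))) m = invDerivSymbol m *
        ∑' p, refl (fun k => E k * a k) p * (E (m - p) * a (m - p)) := fun m => by
      rw [coeff_invDeriv m6a, absSq_eq,
        coeff_mul (memH1_freeProp τ hf).cj.1 (memH1_freeProp τ hf).1, coeff_cj, hF]
    have h3 : ∀ m, coeff (freeProp τ f) m = E m * a m := fun m => congrFun hF m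
    simp only [h2, h3]
    have h1 := tsum_eq_tri_right norm_invDerivSymbol_le hEs.refl hEs hEs k
    rw [h1, mul_left_comm]
    congr 1
    rw [← tri_symbol_mul (m := E)]
    refine tri_congr fun p q => ?_
    rw [hinvE]
    have h3 : (E p)⁻¹ * E q * E (k - p - q)
        = E k * Complex.exp (Complex.I * τ * ((2 * (p + q) * (k - q) : ℤ) : ℂ)) := by
      simp only [hE]
      rw [← Complex.exp_neg, ← Complex.exp_add, ← Complex.exp_add, ← Complex.exp_add]
      congr 1
      push_cast
      ring
    linear_combination (invDerivSymbol (p + q) * refl a p * a q * a (k - p - q)) * h3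
  have e7 : coeff f7 k = E k * (invDerivSymbol k
      * tri (fun _ p q => invDerivSymbol (p + q)) (refl a) a a k) := by
    rw [hf7, coeff_freeProp τ (memH1_invDeriv m7'), coeff_invDeriv m7', mul_comm f,
      coeff_mul m7b.1 hf.1, ← tsum_eq_tri_right norm_invDerivSymbol_le sa.refl sa sa k]
    have h2 : ∀ m, coeff (invDeriv (absSq f)) m = invDerivSymbol m *
        ∑' p, refl a p * a (m - p) := fun m => by
      rw [coeff_invDeriv hf.absSq, absSq_eq, coeff_mul hf.cj.1 hf.1, coeff_cj]
    simp only [h2, ha, hE]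
  have htri : tri (stepSymbol τ) (refl a) a a k =
      (if k = 0 then -Complex.I * τ else 0) * tri (fun _ _ _ => 1) (refl a) a a k
      + ((-(1 / 2) * invDerivSymbol k ^ 2) *
        (tri (fun k p _ => Complex.exp (Complex.I * τ * ((2 * k * p : ℤ) : ℂ))) (refl a) a a k
          - tri (fun _ _ _ => 1) (refl a) a a k)
      + invDerivSymbol k * (tri (fun k p q => invDerivSymbol (p + q)
        * Complex.exp (Complex.I * τ * ((2 * (p + q) * (k - q) : ℤ) : ℂ))) (refl a) a a k
          - tri (fun _ p q => invDerivSymbol (p + q)) (refl a) a a k)) := by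
    have s1 := tri_summable_of_bdd (σ := fun _ _ _ => 1) (C := 1) (by simp) sa.refl sa sa k
    have s2 := tri_summable_of_bdd
      (σ := fun k p _ => Complex.exp (Complex.I * τ * ((2 * k * p : ℤ) : ℂ))) (C := 1)
      (fun k p q => (norm_exp_mul_I_int τ _).le) sa.refl sa sa k
    have s3 := tri_summable_of_bdd (σ := fun k p q => invDerivSymbol (p + q)
        * Complex.exp (Complex.I * τ * ((2 * (p + q) * (k - q) : ℤ) : ℂ))) (C := 1)
      (fun k p q => by rw [norm_mul, norm_exp_mul_I_int, mul_one]; exact norm_invDerivSymbol_le _)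
      sa.refl sa sa k
    have s4 := tri_summable_of_bdd (σ := fun _ p q => invDerivSymbol (p + q)) (C := 1)
      (fun k p q => norm_invDerivSymbol_le _) sa.refl sa sa k
    unfold tri
    rw [← s2.tsum_sub s1, ← s3.tsum_sub s4, ← tsum_mul_left, ← tsum_mul_left, ← tsum_mul_left,
      ← ((s2.sub s1).mul_left _).tsum_add ((s3.sub s4).mul_left _),
      ← (s1.mul_left _).tsum_add (((s2.sub s1).mul_left _).add ((s3.sub s4).mul_left _))]
    refine tsum_congr fun i => ?_
    unfold stepSymbol
    ring
  rw [e1, e4, e5, e6, e7, htri, hc2, hc3, e2, zeroMode_eq_coeff, ← ha]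
  change _ = E k * _
  by_cases hk : k = 0
  · subst hk
    have : E 0 = 1 := by simp [hE]
    simp only [this, if_true]
    ring
  · simp only [hk, if_false]
    ring

/-! ### A mean value inequality -/

lemma sum_weighted_mul_le (F : Finset ℤ) (a b : ℤ → ℂ) :
    ∑ k ∈ F, (1 + (k : ℝ) ^ 2) * (‖a k‖ * ‖b k‖)
      ≤ √(∑ k ∈ F, (1 + (k : ℝ) ^ 2) * ‖a k‖ ^ 2) * √(∑ k ∈ F, (1 + (k : ℝ) ^ 2) * ‖b k‖ ^ 2) := by
  have h := Real.sum_mul_le_sqrt_mul_sqrt F (fun k => jap k * ‖a k‖) (fun k => jap k * ‖b k‖)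
  simp only [mul_pow, jap_sq] at h
  refine le_trans (le_of_eq (Finset.sum_congr rfl fun k _ => ?_)) h
  rw [← jap_sq]
  ring

lemma sqrt_sum_le_seqNorm (F : Finset ℤ) {a : ℤ → ℂ} (ha : SeqH1 a) :
    √(∑ k ∈ F, (1 + (k : ℝ) ^ 2) * ‖a k‖ ^ 2) ≤ seqNorm a :=
  Real.sqrt_le_sqrt (ha.sum_le_tsum F fun k _ => by positivity)

/-- Only coordinatewise derivatives are available, so the increment `D` is paired with a finite
truncation of itself. The scalar mean value theorem and Cauchy-Schwarz bound the truncated norm of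
`D` uniformly in the truncation, which also proves that `D` lies in the space. -/
lemma seqNorm_image_sub_le {w w' : ℝ → ℤ → ℂ} {τ B : ℝ} (hτ : 0 < τ) (hB : 0 ≤ B)
    (hc : ∀ k, ContinuousOn (fun s => w s k) (Icc 0 τ))
    (hd : ∀ s ∈ Ioo 0 τ, ∀ k, HasDerivAt (fun s => w s k) (w' s k) s)
    (hw : ∀ s ∈ Ioo 0 τ, SeqH1 (w' s)) (hb : ∀ s ∈ Ioo 0 τ, seqNorm (w' s) ≤ B) :
    SeqH1 (w τ - w 0) ∧ seqNorm (w τ - w 0) ≤ τ * B := by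
  set D := w τ - w 0 with hD
  have key : ∀ F : Finset ℤ, ∑ k ∈ F, (1 + (k : ℝ) ^ 2) * ‖D k‖ ^ 2 ≤ (τ * B) ^ 2 := by
    intro F
    set A := ∑ k ∈ F, (1 + (k : ℝ) ^ 2) * ‖D k‖ ^ 2 with hA
    have hA0 : 0 ≤ A := Finset.sum_nonneg fun k _ => by positivity
    let φ : ℝ → ℝ := fun s => ∑ k ∈ F, (1 + (k : ℝ) ^ 2) * (conj (D k) * w s k).re
    let φ' : ℝ → ℝ := fun s => ∑ k ∈ F, (1 + (k : ℝ) ^ 2) * (conj (D k) * w' s k).re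
    obtain ⟨ξ, hξ, he⟩ := exists_hasDerivAt_eq_slope φ φ' hτ
      (continuousOn_finsetSum _ fun k _ => continuousOn_const.mul
        (Complex.continuous_re.comp_continuousOn (continuousOn_const.mul (hc k))))
      (fun s hs => by
        refine HasDerivAt.fun_sum fun k _ => HasDerivAt.const_mul _ ?_
        exact Complex.reCLM.hasFDerivAt.comp_hasDerivAt s ((hd s hs k).const_mul (conj (D k))))
    have h1 : φ τ - φ 0 = A := by
      simp only [φ, hA]
      rw [← Finset.sum_sub_distrib]
      refine Finset.sum_congr rfl fun k _ => ?_
      rw [← mul_sub, ← Complex.sub_re, ← mul_sub]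
      congr 1
      change (conj (D k) * D k).re = _
      rw [Complex.conj_mul', ← Complex.ofReal_pow, Complex.ofReal_re]
    have h2 : φ' ξ ≤ √A * B := by
      calc φ' ξ ≤ ∑ k ∈ F, (1 + (k : ℝ) ^ 2) * (‖D k‖ * ‖w' ξ k‖) := by
            refine Finset.sum_le_sum fun k _ => mul_le_mul_of_nonneg_left ?_ (by positivity)
            refine (Complex.re_le_norm _).trans ?_
            rw [norm_mul, RCLike.norm_conj]
        _ ≤ √A * √(∑ k ∈ F, (1 + (k : ℝ) ^ 2) * ‖w' ξ k‖ ^ 2) := sum_weighted_mul_le F D (w' ξ)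
        _ ≤ √A * B := mul_le_mul_of_nonneg_left
            ((sqrt_sum_le_seqNorm F (hw ξ hξ)).trans (hb ξ hξ)) (Real.sqrt_nonneg _)
    rw [h1, sub_zero, eq_div_iff hτ.ne'] at he
    have h3 : √A * √A ≤ √A * (τ * B) := by
      rw [Real.mul_self_sqrt hA0]
      linarith [mul_le_mul_of_nonneg_right h2 hτ.le]
    have h4 : √A ≤ τ * B := by
      rcases (Real.sqrt_nonneg A).eq_or_lt with h0 | h0
      · rw [← h0]; positivity
      · exact le_of_mul_le_mul_left h3 h0
    calc A = √A ^ 2 := (Real.sq_sqrt hA0).symm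
      _ ≤ _ := pow_le_pow_left₀ (Real.sqrt_nonneg _) h4 2
  have hs : SeqH1 D := summable_of_sum_le (fun k => by positivity) key
  refine ⟨hs, ?_⟩
  rw [seqNorm, Real.sqrt_le_left (by positivity)]
  exact hs.tsum_le_of_sum_le key

/-! ### The exact solution on the Fourier side -/

/-- A bounded solution of the equation in terms of Fourier coefficients. -/
structure SeqSolution (T B : ℝ) (U : ℝ → ℤ → ℂ) : Prop where
  seqH1 : ∀ t ∈ Icc 0 T, SeqH1 (U t)
  bound : ∀ t ∈ Icc 0 T, seqNorm (U t) ≤ B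
  cont : ∀ k, ContinuousOn (fun t => U t k) (Icc 0 T)
  deriv : ∀ t ∈ Ioo 0 T, ∀ k : ℤ, HasDerivAt (fun s => U s k) (-Complex.I * ((k : ℂ) ^ 2 * U t k
    + tri (fun _ _ _ => 1) (refl (U t)) (U t) (U t) k)) t

/-- The solution in the interaction picture, started at time `t₀`. -/
def twist (U : ℝ → ℤ → ℂ) (t₀ s : ℝ) (k : ℤ) : ℂ :=
  Complex.exp (Complex.I * s * ((k ^ 2 : ℤ) : ℂ)) * U (t₀ + s) k

/-- The symbol of the nonlinearity in the interaction picture. -/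
def phaseSymbol (s : ℝ) (k p q : ℤ) : ℂ :=
  Complex.exp (Complex.I * s * ((2 * (p + q) * (k - q) : ℤ) : ℂ))

lemma norm_phaseSymbol (s : ℝ) (k p q : ℤ) : ‖phaseSymbol s k p q‖ = 1 := norm_exp_mul_I_int _ _

lemma norm_twist (U : ℝ → ℤ → ℂ) (t₀ s : ℝ) (k : ℤ) : ‖twist U t₀ s k‖ = ‖U (t₀ + s) k‖ := by
  rw [twist, norm_mul, norm_exp_mul_I_int, one_mul]

lemma twist_zero (U : ℝ → ℤ → ℂ) (t₀ : ℝ) : twist U t₀ 0 = U t₀ := by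
  funext k; simp [twist]

lemma refl_twist (U : ℝ → ℤ → ℂ) (t₀ s : ℝ) (k : ℤ) : refl (twist U t₀ s) k
    = Complex.exp (-(Complex.I * s * ((k ^ 2 : ℤ) : ℂ))) * refl (U (t₀ + s)) k := by
  simp only [refl, twist, map_mul]
  congr 1
  rw [← Complex.exp_conj]
  congr 1
  simp

section

variable {T B : ℝ} {U : ℝ → ℤ → ℂ}

lemma SeqSolution.nonneg (h : SeqSolution T B U) (hT : 0 ≤ T) : 0 ≤ B :=
  (seqNorm_nonneg _).trans (h.bound 0 ⟨le_rfl, hT⟩)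

lemma SeqSolution.seqH1_twist (h : SeqSolution T B U) {t₀ s : ℝ} (ht : t₀ + s ∈ Icc 0 T) :
    SeqH1 (twist U t₀ s) := (h.seqH1 _ ht).congr fun k => norm_twist U t₀ s k

lemma SeqSolution.seqNorm_twist_le (h : SeqSolution T B U) {t₀ s : ℝ} (ht : t₀ + s ∈ Icc 0 T) :
    seqNorm (twist U t₀ s) ≤ B :=
  (seqNorm_congr fun k => norm_twist U t₀ s k).trans_le (h.bound _ ht)

/-- The factor `e^{isk²}` cancels the linear term, and `k² + p² - q² - r² = 2(p+q)(k-q)` with `r =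
k-p-q` gives the remaining phase. -/
lemma SeqSolution.hasDerivAt_twist (h : SeqSolution T B U) {t₀ s : ℝ} (ht : t₀ + s ∈ Ioo 0 T)
    (k : ℤ) : HasDerivAt (fun s => twist U t₀ s k) (-Complex.I * tri (phaseSymbol s)
      (refl (twist U t₀ s)) (twist U t₀ s) (twist U t₀ s) k) s := by
  have h1 : HasDerivAt (fun s => U (t₀ + s) k) _ s := HasDerivAt.comp_const_add t₀ s (h.deriv _ ht k)
  have h2 : HasDerivAt (fun s : ℝ => Complex.exp (Complex.I * s * ((k ^ 2 : ℤ) : ℂ)))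
      (Complex.exp (Complex.I * s * ((k ^ 2 : ℤ) : ℂ)) * (Complex.I * 1 * ((k ^ 2 : ℤ) : ℂ))) s :=
    (((Complex.ofRealCLM.hasDerivAt (x := s)).const_mul Complex.I).mul_const _).cexp
  refine (h2.mul h1).congr_deriv ?_
  have h3 : tri (phaseSymbol s) (refl (twist U t₀ s)) (twist U t₀ s) (twist U t₀ s) k
      = tri (fun k _ _ => Complex.exp (Complex.I * s * ((k ^ 2 : ℤ) : ℂ)) * 1)
        (refl (U (t₀ + s))) (U (t₀ + s)) (U (t₀ + s)) k := by
    refine tri_congr fun p q => ?_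
    rw [refl_twist]
    have h4 : Complex.exp (Complex.I * s * ((k ^ 2 : ℤ) : ℂ)) = phaseSymbol s k p q *
        Complex.exp (-(Complex.I * s * ((p ^ 2 : ℤ) : ℂ))) *
        Complex.exp (Complex.I * s * ((q ^ 2 : ℤ) : ℂ)) *
        Complex.exp (Complex.I * s * (((k - p - q) ^ 2 : ℤ) : ℂ)) := by
      rw [phaseSymbol, ← Complex.exp_add, ← Complex.exp_add, ← Complex.exp_add]
      congr 1
      push_cast
      ring
    rw [h4]
    simp only [twist]
    ring
  rw [h3, tri_symbol_mul (σ := fun _ _ _ => 1)]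
  push_cast
  ring

lemma SeqSolution.continuousOn_twist (h : SeqSolution T B U) {t₀ τ : ℝ} (h0 : 0 ≤ t₀)
    (hT : t₀ + τ ≤ T) (k : ℤ) : ContinuousOn (fun s => twist U t₀ s k) (Icc 0 τ) := by
  refine ContinuousOn.mul (by fun_prop) ((h.cont k).comp (by fun_prop) fun s hs => ?_)
  exact ⟨by linarith [hs.1], by linarith [hs.2]⟩

lemma SeqSolution.seqNorm_twist_sub_le (h : SeqSolution T B U) {S : ℝ}
    (hS : IsWeight (fun _ => 1) S) {t₀ τ : ℝ} (h0 : 0 ≤ t₀) (hτ : 0 ≤ τ) (hT : t₀ + τ ≤ T) :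
    SeqH1 (twist U t₀ τ - twist U t₀ 0) ∧
      seqNorm (twist U t₀ τ - twist U t₀ 0) ≤ τ * (3 * S * B ^ 3) := by
  have hB := h.nonneg (h0.trans (by linarith))
  have hS0 := hS.sum_nonneg
  rcases hτ.eq_or_lt with rfl | hτ
  · rw [sub_self, zero_mul]
    constructor
    · simp [SeqH1]
    · simp [seqNorm]
  have hb : ∀ s ∈ Ioo 0 τ, SeqH1 (-tri (fun k p q => Complex.I * phaseSymbol s k p q)
        (refl (twist U t₀ s)) (twist U t₀ s) (twist U t₀ s)) ∧
      seqNorm (-tri (fun k p q => Complex.I * phaseSymbol s k p q)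
        (refl (twist U t₀ s)) (twist U t₀ s) (twist U t₀ s)) ≤ 3 * S * B ^ 3 := by
    intro s hs
    have hm : t₀ + s ∈ Icc 0 T := ⟨by linarith [hs.1], by linarith [hs.2]⟩
    have hV := h.seqH1_twist hm
    have hN := h.seqNorm_twist_le hm
    have hn := seqNorm_nonneg (twist U t₀ s)
    have := tri_bound (σ := fun k p q => Complex.I * phaseSymbol s k p q) hS zero_le_one
      (symbolBound_of_bdd fun k p q => by simp [norm_phaseSymbol]) hV.refl hV hV
    refine ⟨this.1.neg, ?_⟩
    rw [seqNorm_neg]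
    refine this.2.trans ?_
    rw [seqNorm_refl]
    calc _ ≤ 3 * 1 * S * B * B * B := by gcongr
      _ = _ := by ring
  refine seqNorm_image_sub_le (w := twist U t₀) hτ (by positivity)
    (h.continuousOn_twist h0 hT) (fun s hs k => ?_) (fun s hs => (hb s hs).1)
    (fun s hs => (hb s hs).2)
  refine (h.hasDerivAt_twist ⟨by linarith [hs.1], by linarith [hs.2]⟩ k).congr_deriv ?_
  rw [Pi.neg_apply, tri_symbol_mul (m := fun _ => Complex.I), neg_mul]

/-- The symbol of the first Picard iterate. -/
def duhamelSymbol (s : ℝ) (k p q : ℤ) : ℂ := ∫ x in (0 : ℝ)..s, -Complex.I * phaseSymbol x k p q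

lemma continuous_phaseSymbol (k p q : ℤ) : Continuous fun x => phaseSymbol x k p q := by
  unfold phaseSymbol; fun_prop

lemma hasDerivAt_duhamelSymbol (s : ℝ) (k p q : ℤ) :
    HasDerivAt (fun s => duhamelSymbol s k p q) (-Complex.I * phaseSymbol s k p q) s :=
  ((continuous_const.mul (continuous_phaseSymbol k p q)).integral_hasStrictDerivAt 0 s).hasDerivAt

/-- Termwise differentiation: the phases have modulus one, so the absolutely summable series of
products dominates the derivatives. -/
lemma hasDerivAt_tri_duhamelSymbol {a b c : ℤ → ℂ} (ha : SeqH1 a) (hb : SeqH1 b) (hc : SeqH1 c)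
    (k : ℤ) (s : ℝ) : HasDerivAt (fun s => tri (duhamelSymbol s) a b c k)
      (tri (fun k p q => -Complex.I * phaseSymbol s k p q) a b c k) s := by
  refine hasDerivAt_tsum (u := fun i : ℤ × ℤ => ‖(1 : ℂ) * (a i.1 * b i.2 * c (k - i.1 - i.2))‖)
    (y₀ := 0)
    (tri_summable_of_bdd (σ := fun _ _ _ => 1) (C := 1) (by simp) ha hb hc k).norm
    (fun i y => (hasDerivAt_duhamelSymbol y k i.1 i.2).mul_const _) (fun i y => ?_) ?_ s
  · rw [norm_mul, norm_mul (1 : ℂ)]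
    simp [norm_phaseSymbol]
  · simp [duhamelSymbol]

/-- The filtered solution moves by `O(s)` in time `s`, so freezing it at `t₀` changes the derivative
by `O(s)`, and integration gives `O(τ²)`. The constant is the trilinear Lipschitz factor `9SB²`
times the speed `3SB³`. -/
lemma SeqSolution.duhamel (h : SeqSolution T B U) {S : ℝ}
    (hS : IsWeight (fun _ => 1) S) {t₀ τ : ℝ} (h0 : 0 ≤ t₀) (hτ : 0 < τ) (hT : t₀ + τ ≤ T) :
    SeqH1 (twist U t₀ τ - U t₀ - tri (duhamelSymbol τ) (refl (U t₀)) (U t₀) (U t₀)) ∧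
      seqNorm (twist U t₀ τ - U t₀ - tri (duhamelSymbol τ) (refl (U t₀)) (U t₀) (U t₀))
        ≤ τ ^ 2 * (27 * S ^ 2 * B ^ 5) := by
  have hB := h.nonneg (h0.trans (by linarith))
  have hS0 := hS.sum_nonneg
  have m0 : t₀ ∈ Icc 0 T := ⟨h0, by linarith⟩
  have hU := h.seqH1 t₀ m0
  have hUB := h.bound t₀ m0
  set W : ℝ → ℤ → ℂ := fun s => twist U t₀ s - tri (duhamelSymbol s) (refl (U t₀)) (U t₀) (U t₀)
    with hW
  set W' : ℝ → ℤ → ℂ := fun s =>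
    tri (fun k p q => -Complex.I * phaseSymbol s k p q) (refl (twist U t₀ s)) (twist U t₀ s)
      (twist U t₀ s) -
    tri (fun k p q => -Complex.I * phaseSymbol s k p q) (refl (U t₀)) (U t₀) (U t₀) with hW'
  have hbd : ∀ s, ∀ k p q, ‖-Complex.I * phaseSymbol s k p q‖ ≤ 1 := fun s k p q => by
    simp [norm_phaseSymbol]
  have hb : ∀ s ∈ Ioo 0 τ, SeqH1 (W' s) ∧ seqNorm (W' s) ≤ τ * (27 * S ^ 2 * B ^ 5) := by
    intro s hs
    have hm : t₀ + s ∈ Icc 0 T := ⟨by linarith [hs.1], by linarith [hs.2]⟩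
    have hV := h.seqH1_twist hm
    have hN := h.seqNorm_twist_le hm
    have hl := h.seqNorm_twist_sub_le hS h0 hs.1.le (by linarith [hs.2])
    rw [twist_zero] at hl
    refine ⟨(seqH1_tri_of_bdd (hbd s) hV.refl hV hV).sub
      (seqH1_tri_of_bdd (hbd s) hU.refl hU hU), ?_⟩
    refine (tri_sub_bound hS zero_le_one (symbolBound_of_bdd (hbd s)) hV.refl hV hV
      hU.refl hU hU hN hN ((seqNorm_refl _).trans_le hUB) hUB
      ((by rw [refl_sub, seqNorm_refl]; exact hl.2)) hl.2 hl.2).trans ?_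
    have : s ≤ τ := hs.2.le
    calc 9 * 1 * S * B ^ 2 * (s * (3 * S * B ^ 3)) = s * (27 * S ^ 2 * B ^ 5) := by ring
      _ ≤ _ := by gcongr
  have hmv := seqNorm_image_sub_le (w := W) (w' := W') hτ (by positivity)
    (fun k => (h.continuousOn_twist h0 hT k).sub fun s _ =>
      (hasDerivAt_tri_duhamelSymbol hU.refl hU hU k s).continuousAt.continuousWithinAt)
    (fun s hs k => by
      refine ((h.hasDerivAt_twist ⟨by linarith [hs.1], by linarith [hs.2]⟩ k).sub
        (hasDerivAt_tri_duhamelSymbol hU.refl hU hU k s)).congr_deriv ?_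
      simp only [hW', Pi.sub_apply]
      rw [tri_symbol_mul (m := fun _ => -Complex.I) (a := refl (twist U t₀ s))])
    (fun s hs => (hb s hs).1) (fun s hs => (hb s hs).2)
  have hE : tri (duhamelSymbol 0) (refl (U t₀)) (U t₀) (U t₀) = 0 := by
    funext k; simp [tri, duhamelSymbol]
  have : W τ - W 0 = twist U t₀ τ - U t₀ - tri (duhamelSymbol τ) (refl (U t₀)) (U t₀) (U t₀) := by
    simp only [hW, hE, twist_zero]
    abel
  rw [this] at hmv
  exact ⟨hmv.1, hmv.2.trans (le_of_eq (by ring))⟩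

end

/-! ### Conservation of mass and momentum -/

lemma SeqH1.summable_sq {a : ℤ → ℂ} (ha : SeqH1 a) : Summable fun k => ‖a k‖ ^ 2 :=
  Summable.of_nonneg_of_le (fun k => by positivity)
    (fun k => le_mul_of_one_le_left (by positivity) (by nlinarith [sq_nonneg (k : ℝ)])) ha

/-- With `d` the coefficients of the real density `|f|²`, the sum is the imaginary part of `Q = ∑ (α
+ βk) ā_k d_m a_{k-m}`. Conjugation exchanges `k` and `k-m`, so `Q - Q̄ = β ∑ m d_m d_{-m}`, which
vanishes by oddness. The weight `1` gives mass, the weight `k` momentum. -/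
lemma hasSum_conserved_density {a : ℤ → ℂ} (ha : SeqH1 a) (α β : ℝ) :
    HasSum (fun k : ℤ => (α + β * k) *
      (conj (a k) * tri (fun _ _ _ => 1) (refl a) a a k).im) 0 := by
  set d : ℤ → ℂ := fun m => ∑' p, refl a p * a (m - p) with hd
  have hds : SeqH1 d := seqH1_conv ha.refl ha
  have hN : ∀ k, tri (fun _ _ _ => 1) (refl a) a a k = ∑' m, d m * a (k - m) := fun k => by
    rw [← tsum_eq_tri_right (h := fun _ => 1) (C := 1) (by simp) ha.refl ha ha]
    simp [hd]
  have hdr : ∀ m, conj (d (-m)) = d m := fun m => by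
    simp only [hd, refl]
    rw [← (Equiv.addLeft m).tsum_eq (fun p => conj (a (-p)) * a (m - p)), Complex.conj_tsum]
    refine tsum_congr fun p => ?_
    simp only [map_mul, Complex.conj_conj, Equiv.coe_addLeft]
    rw [show m - (m + p) = -p by ring, show -(m + p) = -m - p by ring, mul_comm]
  have hdn : ∀ m, d (-m) = ∑' k, conj (a k) * a (k - m) := fun m => by
    simp only [hd, refl]
    rw [← (Equiv.neg ℤ).tsum_eq]
    refine tsum_congr fun p => ?_
    simp only [Equiv.neg_apply, neg_neg]
    rw [show -m - -p = p - m by ring]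
  set X : ℤ × ℤ → ℂ := fun i => conj (a i.1) * (d i.2 * a (i.1 - i.2)) with hX
  let shear : ℤ × ℤ ≃ ℤ × ℤ :=
    ⟨fun i => (i.1 - i.2, i.2), fun i => (i.1 + i.2, i.2), fun i => by ext <;> simp,
      fun i => by ext <;> simp⟩
  -- The involution `(k, m) ↦ (k-m, -m)` realises complex conjugation of the summand.
  let e : ℤ × ℤ ≃ ℤ × ℤ :=
    ⟨fun i => (i.1 - i.2, -i.2), fun i => (i.1 - i.2, -i.2), fun i => by ext <;> simp,
      fun i => by ext <;> simp⟩
  have hsum : ∀ α β : ℝ, Summable fun i : ℤ × ℤ => ((α + β * i.1 : ℝ) : ℂ) * X i := by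
    intro α β
    have h1 : Summable fun k : ℤ => (α + β * k) ^ 2 * ‖a k‖ ^ 2 := by
      refine Summable.of_nonneg_of_le (fun k => by positivity) (fun k => ?_)
        (ha.mul_left (α ^ 2 + β ^ 2))
      have : (α + β * k) ^ 2 ≤ (α ^ 2 + β ^ 2) * (1 + (k : ℝ) ^ 2) := by
        nlinarith [sq_nonneg (α * k - β)]
      rw [← mul_assoc]
      exact mul_le_mul_of_nonneg_right this (by positivity)
    have h2 := h1.mul_of_nonneg hds.summable_norm (fun k => by positivity) (fun k => norm_nonneg _)
    have h3 := shear.summable_iff.2 (ha.summable_sq.mul_of_nonneg hds.summable_norm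
      (fun k => by positivity) (fun k => norm_nonneg _))
    refine Summable.of_norm_bounded (h2.add h3) fun i => ?_
    simp only [hX, shear, Function.comp, Equiv.coe_fn_mk, norm_mul, Complex.norm_real,
      RCLike.norm_conj, Real.norm_eq_abs]
    rw [← sq_abs (α + β * i.1)]
    -- Splitting the product by `2xy ≤ x² + y²` puts the linear weight on a single factor, where
    -- `H¹` absorbs its square.
    have h4 := two_mul_le_add_sq (|α + β * (i.1 : ℝ)| * ‖a i.1‖) ‖a (i.1 - i.2)‖
    have h5 := norm_nonneg (d i.2)
    have h6 : 0 ≤ |α + β * (i.1 : ℝ)| * ‖a i.1‖ * ‖a (i.1 - i.2)‖ := by positivity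
    nlinarith [mul_le_mul_of_nonneg_right h4 h5, mul_nonneg h6 h5]
  have hs1 := hsum α β
  set Q : ℂ := ∑' i : ℤ × ℤ, ((α + β * i.1 : ℝ) : ℂ) * X i with hQ
  have hXe : ∀ i, conj (X (e i)) = X i := fun i => by
    simp only [hX, e, Equiv.coe_fn_mk, map_mul, Complex.conj_conj, hdr]
    rw [show i.1 - i.2 - -i.2 = i.1 by ring]
    ring
  have hQc : conj Q = ∑' i : ℤ × ℤ, ((α + β * (i.1 - i.2) : ℝ) : ℂ) * X i := by
    rw [hQ, ← e.tsum_eq, Complex.conj_tsum]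
    refine tsum_congr fun i => ?_
    rw [map_mul, hXe, Complex.conj_ofReal]
    simp [e]
  have hs2 : Summable fun i : ℤ × ℤ => ((α + β * (i.1 - i.2) : ℝ) : ℂ) * X i := by
    have := (Complex.conjCLE.toContinuousLinearMap.summable (e.summable_iff.2 hs1))
    refine this.congr fun i => ?_
    simp only [Function.comp, ContinuousLinearEquiv.coe_coe, Complex.conjCLE_apply]
    rw [map_mul, hXe, Complex.conj_ofReal]
    simp [e]
  have hQs : Q - conj Q = ∑' i : ℤ × ℤ, ((β * i.2 : ℝ) : ℂ) * X i := by
    rw [hQc, hQ, ← hs1.tsum_sub hs2]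
    refine tsum_congr fun i => ?_
    push_cast
    ring
  have hs3 : Summable fun i : ℤ × ℤ => ((β * i.2 : ℝ) : ℂ) * X i := by
    refine (hs1.sub hs2).congr fun i => ?_
    push_cast
    ring
  have hzero : ∑' i : ℤ × ℤ, ((β * i.2 : ℝ) : ℂ) * X i = 0 := by
    have hs4 := (Equiv.prodComm ℤ ℤ).summable_iff.2 hs3
    have h1 : ∑' i : ℤ × ℤ, ((β * i.2 : ℝ) : ℂ) * X i
        = ∑' m : ℤ, ((β * m : ℝ) : ℂ) * (d m * d (-m)) := by
      rw [← (Equiv.prodComm ℤ ℤ).tsum_eq]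
      refine hs4.tsum_prod.trans (tsum_congr fun m => ?_)
      rw [hdn, ← tsum_mul_left, ← tsum_mul_left]
      refine tsum_congr fun k => ?_
      simp only [Function.comp, Equiv.prodComm_apply, Prod.swap_prod_mk, hX]
      ring
    rw [h1]
    have h2 : ∑' m : ℤ, ((β * m : ℝ) : ℂ) * (d m * d (-m))
        = -∑' m : ℤ, ((β * m : ℝ) : ℂ) * (d m * d (-m)) := by
      conv_lhs => rw [← (Equiv.neg ℤ).tsum_eq]
      rw [← tsum_neg]
      refine tsum_congr fun m => ?_
      simp only [Equiv.neg_apply, neg_neg]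
      push_cast
      ring
    exact self_eq_neg.1 h2
  have hQim : Q.im = 0 := by
    rw [hzero] at hQs
    exact Complex.conj_eq_iff_im.1 (sub_eq_zero.1 hQs).symm
  have hQsum : HasSum (fun k : ℤ => ((α + β * k : ℝ) : ℂ) *
      (conj (a k) * tri (fun _ _ _ => 1) (refl a) a a k)) Q := by
    refine hs1.hasSum.prod_fiberwise fun k => ?_
    rw [hN, ← tsum_mul_left, ← tsum_mul_left]
    exact (hs1.prod_factor k).hasSum
  have := Complex.hasSum_im hQsum
  rw [hQim] at this
  refine this.congr_fun fun k => ?_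
  rw [Complex.im_ofReal_mul]

/-- Finite partial sums are differentiable in time. Their derivatives are bounded uniformly in the
truncation and tend to `0` pointwise by `hasSum_conserved_density`, so dominated convergence in the
integrated identity gives conservation. -/
lemma SeqSolution.conserved {T B : ℝ} {U : ℝ → ℤ → ℂ} (h : SeqSolution T B U) (α β : ℝ) {t : ℝ}
    (h0 : 0 ≤ t) (hT : t < T) :
    ∑' k : ℤ, (α + β * k) * ‖U t k‖ ^ 2 = ∑' k : ℤ, (α + β * k) * ‖U 0 k‖ ^ 2 := by
  obtain ⟨S, hS⟩ := exists_isWeight_one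
  have hB := h.nonneg (h0.trans hT.le)
  have hS0 := hS.sum_nonneg
  set N : ℝ → ℤ → ℂ := fun s => tri (fun _ _ _ => 1) (refl (U s)) (U s) (U s) with hN
  let φ : Finset ℤ → ℝ → ℝ := fun F s => ∑ k ∈ F, (α + β * k) * ‖U s k‖ ^ 2
  let φ' : Finset ℤ → ℝ → ℝ := fun F s =>
    ∑ k ∈ F, 2 * ((α + β * k) * (conj (U s k) * N s k).im)
  have hderiv : ∀ F, ∀ s ∈ Ioo 0 T, HasDerivAt (φ F) (φ' F s) s := by
    intro F s hs
    refine HasDerivAt.fun_sum fun k _ => ?_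
    have h1 := ((h.deriv s hs k).norm_sq).const_mul (α + β * (k : ℝ))
    refine h1.congr_deriv ?_
    rw [Complex.inner]
    have : ((-Complex.I * ((k : ℂ) ^ 2 * U s k + N s k)) * conj (U s k)).re
        = (conj (U s k) * N s k).im := by
      have e1 : (-Complex.I * ((k : ℂ) ^ 2 * U s k + N s k)) * conj (U s k)
          = -Complex.I * (((k : ℝ) ^ 2 * ‖U s k‖ ^ 2 : ℝ) + conj (U s k) * N s k) := by
        push_cast
        rw [← Complex.mul_conj']
        ring
      rw [e1, neg_mul, Complex.neg_re, Complex.I_mul_re, Complex.add_im, Complex.ofReal_im,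
        zero_add, neg_neg]
    rw [hN] at this
    simp only at this
    rw [this]
    ring
  have hbound : ∀ F, ∀ s ∈ Ioo 0 T, ‖φ' F s‖ ≤ 2 * (|α| + |β|) * (B * (3 * S * B ^ 3)) := by
    intro F s hs
    have hU := h.seqH1 s (Ioo_subset_Icc_self hs)
    have hUB := h.bound s (Ioo_subset_Icc_self hs)
    have hn := seqNorm_nonneg (U s)
    have ht := tri_bound (σ := fun _ _ _ => 1) hS zero_le_one
      (symbolBound_of_bdd (by simp)) hU.refl hU hU
    rw [seqNorm_refl] at ht
    have ht2 : seqNorm (N s) ≤ 3 * S * B ^ 3 := ht.2.trans (by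
      calc _ ≤ 3 * 1 * S * B * B * B := by gcongr
        _ = _ := by ring)
    calc ‖φ' F s‖ ≤ ∑ k ∈ F, 2 * (|α| + |β|) * ((1 + (k : ℝ) ^ 2) * (‖U s k‖ * ‖N s k‖)) := by
          refine norm_sum_le_of_le _ fun k _ => ?_
          rw [norm_mul, norm_mul, Real.norm_eq_abs, Real.norm_eq_abs, Real.norm_eq_abs, abs_two,
            mul_assoc 2]
          refine mul_le_mul_of_nonneg_left ?_ zero_le_two
          rw [← mul_assoc]
          refine mul_le_mul ?_ ((Complex.abs_im_le_norm _).trans ?_) (abs_nonneg _) (by positivity)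
          · refine (abs_add_le _ _).trans ?_
            rw [abs_mul]
            have h1 : |(k : ℝ)| ≤ 1 + (k : ℝ) ^ 2 := by
              nlinarith [sq_abs (k : ℝ), sq_nonneg (|(k : ℝ)| - 1)]
            nlinarith [abs_nonneg α, abs_nonneg β, sq_nonneg (k : ℝ),
              mul_le_mul_of_nonneg_left h1 (abs_nonneg β),
              mul_nonneg (abs_nonneg α) (sq_nonneg (k : ℝ))]
          · rw [norm_mul, RCLike.norm_conj]
      _ ≤ 2 * (|α| + |β|) * (B * (3 * S * B ^ 3)) := by
          rw [← Finset.mul_sum]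
          refine mul_le_mul_of_nonneg_left ?_ (by positivity)
          refine (sum_weighted_mul_le F _ _).trans ?_
          exact mul_le_mul ((sqrt_sum_le_seqNorm F hU).trans hUB)
            ((sqrt_sum_le_seqNorm F ht.1).trans ht2) (Real.sqrt_nonneg _) hB
  have hsub : ∀ s ∈ uIoc 0 t, s ∈ Ioo 0 T := fun s hs => by
    rw [uIoc_of_le h0] at hs
    exact ⟨hs.1, hs.2.trans_lt hT⟩
  -- Instead of proving continuity of the derivative, its measurability is taken from the fact that
  -- it is a derivative.
  have hmeas : ∀ F, AEStronglyMeasurable (φ' F) (volume.restrict (uIoc 0 t)) := fun F => by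
    have h1 : AEStronglyMeasurable (_root_.deriv (φ F)) (volume.restrict (uIoc 0 t)) :=
      (measurable_deriv (φ F)).aestronglyMeasurable
    refine h1.congr ?_
    filter_upwards [ae_restrict_mem measurableSet_uIoc] with s hs
    exact (hderiv F s (hsub s hs)).deriv
  have hint : ∀ F, ∫ s in (0 : ℝ)..t, φ' F s = φ F t - φ F 0 := by
    intro F
    refine intervalIntegral.integral_eq_sub_of_hasDerivAt_of_le h0 ?_
      (fun s hs => hderiv F s ⟨hs.1, hs.2.trans hT⟩) ?_
    · refine continuousOn_finsetSum _ fun k _ => continuousOn_const.mul ?_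
      exact (((h.cont k).mono (Icc_subset_Icc_right hT.le)).norm).pow 2
    · refine (intervalIntegrable_const (c := 2 * (|α| + |β|) * (B * (3 * S * B ^ 3)))).mono_fun'
        (hmeas F) ?_
      filter_upwards [ae_restrict_mem measurableSet_uIoc] with s hs
      exact hbound F s (hsub s hs)
  have hlim := intervalIntegral.tendsto_integral_filter_of_dominated_convergence
    (l := atTop) (F := φ') (f := fun _ => (0 : ℝ)) (a := 0) (b := t) (μ := volume)
    (fun _ => 2 * (|α| + |β|) * (B * (3 * S * B ^ 3)))
    (Eventually.of_forall hmeas)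
    (Eventually.of_forall fun F => Eventually.of_forall fun s hs => hbound F s (hsub s hs))
    intervalIntegrable_const
    (Eventually.of_forall fun s hs => by
      have := (hasSum_conserved_density (h.seqH1 s (Ioo_subset_Icc_self (hsub s hs))) α β).mul_left 2
      rw [mul_zero] at this
      exact this)
  simp only [hint, intervalIntegral.integral_zero] at hlim
  have hs : ∀ s ∈ Icc 0 T, HasSum (fun k : ℤ => (α + β * k) * ‖U s k‖ ^ 2)
      (∑' k : ℤ, (α + β * k) * ‖U s k‖ ^ 2) := fun s hs => by
    refine Summable.hasSum (Summable.of_norm_bounded ((h.seqH1 s hs).mul_left (|α| + |β|))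
      fun k => ?_)
    rw [norm_mul, Real.norm_eq_abs, norm_pow, norm_norm, ← mul_assoc]
    refine mul_le_mul_of_nonneg_right ?_ (by positivity)
    refine (abs_add_le _ _).trans ?_
    rw [abs_mul]
    have h1 : |(k : ℝ)| ≤ 1 + (k : ℝ) ^ 2 := by
      nlinarith [sq_abs (k : ℝ), sq_nonneg (|(k : ℝ)| - 1)]
    nlinarith [abs_nonneg α, abs_nonneg β, sq_nonneg (k : ℝ),
      mul_le_mul_of_nonneg_left h1 (abs_nonneg β),
      mul_nonneg (abs_nonneg α) (sq_nonneg (k : ℝ))]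
  have h2 := (hs t ⟨h0, hT.le⟩).sub (hs 0 ⟨le_rfl, h0.trans hT.le⟩)
  have h3 : Tendsto (fun F => φ F t - φ F 0) atTop (𝓝 (∑' k : ℤ, (α + β * k) * ‖U t k‖ ^ 2
      - ∑' k : ℤ, (α + β * k) * ‖U 0 k‖ ^ 2)) := by
    simpa only [HasSum, SummationFilter.unconditional_filter, Finset.sum_sub_distrib] using h2
  exact sub_eq_zero.1 (tendsto_nhds_unique h3 hlim)

/-! ### Estimates for the symbols -/

lemma norm_exp_I_mul_sub_one_le (s : ℝ) (m : ℤ) :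
    ‖Complex.exp (Complex.I * s * m) - 1‖ ≤ |s| * |(m : ℝ)| := by
  have h := Real.norm_exp_I_mul_ofReal_sub_one_le (x := s * m)
  rw [Real.norm_eq_abs, abs_mul] at h
  convert h using 4
  push_cast
  ring

lemma norm_exp_I_mul_sub_one_le_two (s : ℝ) (m : ℤ) :
    ‖Complex.exp (Complex.I * s * m) - 1‖ ≤ 2 := by
  refine (norm_sub_le _ _).trans ?_
  rw [norm_exp_mul_I_int, norm_one]
  norm_num

lemma norm_exp_neg_I_mul_taylor_le (y : ℝ) :
    ‖Complex.exp (-Complex.I * (y : ℂ)) - 1 - -Complex.I * (y : ℂ)‖ ≤ 3 * y ^ 2 := by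
  have hn : ‖-Complex.I * (y : ℂ)‖ = |y| := by simp
  rcases le_or_gt |y| 1 with h | h
  · have := Complex.norm_exp_sub_one_sub_id_le (x := -Complex.I * (y : ℂ)) (by rwa [hn])
    rw [hn, sq_abs] at this
    nlinarith [sq_nonneg y]
  · refine (norm_sub_le _ _).trans ?_
    have h1 : ‖Complex.exp (-Complex.I * (y : ℂ)) - 1‖ ≤ 2 := by
      refine (norm_sub_le _ _).trans ?_
      rw [norm_exp_of_re_zero (by simp), norm_one]
      norm_num
    rw [hn]
    have : 1 ≤ y ^ 2 := by rw [← sq_abs]; nlinarith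
    nlinarith [sq_abs y]

/-- Interpolation between the trivial bound `2` and the linear bound `2x`; it turns phase
differences into fractional powers. -/
lemma min_two_le_rpow {x θ : ℝ} (hx : 0 ≤ x) (h0 : 0 ≤ θ) (h1 : θ ≤ 1) {y : ℝ} (hy : y ≤ 2)
    (hy' : y ≤ 2 * x) : y ≤ 2 * x ^ θ := by
  rcases le_total x 1 with h | h
  · refine hy'.trans ?_
    have := Real.rpow_le_rpow_of_exponent_ge' hx h h0 h1
    rw [Real.rpow_one] at this
    linarith
  · have := Real.one_le_rpow h h0
    linarith

lemma jap_le_two_mul_abs {k : ℤ} (hk : k ≠ 0) : jap k ≤ 2 * |(k : ℝ)| := by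
  have : (1 : ℝ) ≤ |(k : ℝ)| := by exact_mod_cast Int.one_le_abs hk
  linarith [jap_le_one_add_abs k]

/-- A factor `1/|k|` absorbs the output weight. At `k = 0` the quotient is `0` by convention, so no
case distinction is needed later. -/
lemma norm_div_mul_jap_le {x : ℝ} (hx : 0 ≤ x) (k : ℤ) : x / |(k : ℝ)| * jap k ≤ 2 * x := by
  by_cases hk : k = 0
  · subst hk; simpa using hx
  · have h0 : 0 < |(k : ℝ)| := abs_pos.2 (by exact_mod_cast hk)
    rw [div_mul_eq_mul_div, div_le_iff₀ h0]
    nlinarith [jap_le_two_mul_abs hk]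

lemma norm_invDerivSymbol (k : ℤ) : ‖invDerivSymbol k‖ = 1 / |(k : ℝ)| := by
  unfold invDerivSymbol
  split_ifs with h
  · simp [h]
  · rw [norm_inv, norm_mul, Complex.norm_I, one_mul, Complex.norm_intCast, one_div]

lemma abs_sub_le_jap (k p q : ℤ) : |((k - q : ℤ) : ℝ)| ≤ jap p + jap (k - p - q) := by
  have : ((k - q : ℤ) : ℝ) = p + ((k - p - q : ℤ) : ℝ) := by push_cast; ring
  rw [this]
  exact (abs_add_le _ _).trans (add_le_add (abs_le_jap _) (abs_le_jap _))

lemma abs_add_le_jap (p q : ℤ) : |((p + q : ℤ) : ℝ)| ≤ jap p + jap q := by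
  push_cast
  exact (abs_add_le _ _).trans (add_le_add (abs_le_jap _) (abs_le_jap _))

/-- Bounding `|e^{iτm} - 1| ≤ τ|m|` cancels one factor `1/|k|` in the first term and `1/|p+q|` in
the second. What is left is `τ(|p| + 2|k-q|)/|k|`: one power of frequency against the output weight,
with a gain of `τ`. -/
lemma symbolBound_stepSymbol {τ : ℝ} (hτ : 0 ≤ τ) :
    SymbolBound (fun _ => 1) (6 * τ) (stepSymbol τ) := by
  intro k p q
  simp only [mul_one, one_mul]
  have jp := jap_pos p
  have jq := jap_pos q
  have jr := jap_pos (k - p - q)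
  by_cases hk : k = 0
  · subst hk
    have h1 : stepSymbol τ 0 p q = -Complex.I * τ := by simp [stepSymbol, invDerivSymbol]
    have h2 : jap 0 = 1 := by simp [jap]
    rw [h1, h2]
    have : ‖-Complex.I * (τ : ℂ)‖ = τ := by simp [abs_of_nonneg hτ]
    rw [this]
    nlinarith [one_le_jap p, mul_nonneg hτ jp.le, mul_nonneg hτ jq.le, mul_nonneg hτ jr.le,
      mul_le_mul_of_nonneg_left (one_le_jap p) hτ]
  · have hk0 : 0 < |(k : ℝ)| := abs_pos.2 (by exact_mod_cast hk)
    have e1 : ‖-(1 / 2) * invDerivSymbol k ^ 2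
        * (Complex.exp (Complex.I * τ * ((2 * k * p : ℤ) : ℂ)) - 1)‖
        ≤ (τ * |(p : ℝ)|) / |(k : ℝ)| := by
      rw [norm_mul, norm_mul, norm_pow, norm_invDerivSymbol]
      have h := norm_exp_I_mul_sub_one_le τ (2 * k * p)
      rw [abs_of_nonneg hτ] at h
      have h3 : ‖(-(1 / 2) : ℂ)‖ = 1 / 2 := by norm_num
      rw [h3]
      calc _ ≤ 1 / 2 * (1 / |(k : ℝ)|) ^ 2 * (τ * |((2 * k * p : ℤ) : ℝ)|) := by gcongr
        _ = _ := by
          push_cast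
          rw [abs_mul, abs_mul, abs_two]
          field_simp
    have e2 : ‖invDerivSymbol k * (invDerivSymbol (p + q)
        * (Complex.exp (Complex.I * τ * ((2 * (p + q) * (k - q) : ℤ) : ℂ)) - 1))‖
        ≤ (2 * τ * |((k - q : ℤ) : ℝ)|) / |(k : ℝ)| := by
      rw [norm_mul, norm_mul, norm_invDerivSymbol, norm_invDerivSymbol]
      have h := norm_exp_I_mul_sub_one_le τ (2 * (p + q) * (k - q))
      rw [abs_of_nonneg hτ] at h
      calc _ ≤ 1 / |(k : ℝ)| * (1 / |((p + q : ℤ) : ℝ)|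
            * (τ * |((2 * (p + q) * (k - q) : ℤ) : ℝ)|)) := by gcongr
        _ ≤ _ := by
          rw [Int.cast_mul, Int.cast_mul, abs_mul, abs_mul]
          rw [one_div, inv_mul_eq_div]
          refine div_le_div_of_nonneg_right ?_ hk0.le
          by_cases h0 : p + q = 0
          · rw [h0]; simp; positivity
          · have : 0 < |((p + q : ℤ) : ℝ)| := abs_pos.2 (by exact_mod_cast h0)
            refine le_of_eq ?_
            have h2 : |((2 : ℤ) : ℝ)| = 2 := by norm_num
            rw [h2]
            field_simp
    have e3 : ‖stepSymbol τ k p q‖ ≤ (τ * |(p : ℝ)| + 2 * τ * |((k - q : ℤ) : ℝ)|) / |(k : ℝ)| := by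
      rw [stepSymbol, if_neg hk, zero_add, add_div]
      exact (norm_add_le _ _).trans (add_le_add e1 e2)
    refine (mul_le_mul_of_nonneg_right e3 (jap_pos k).le).trans ?_
    refine (norm_div_mul_jap_le (by positivity) k).trans ?_
    have h1 := mul_le_mul_of_nonneg_left (abs_le_jap p) hτ
    have h2 := mul_le_mul_of_nonneg_left (abs_sub_le_jap k p q) hτ
    nlinarith [mul_nonneg hτ jq.le, mul_nonneg hτ jr.le]

/-- The integral `-i ∫₀^τ e^{ixm} dx`. -/
def expIntegral (τ : ℝ) (m : ℤ) : ℂ := ∫ x in (0 : ℝ)..τ, -Complex.I * Complex.exp (Complex.I * x * m)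

/-- The product form, unlike the quotient, remains true at the resonance `m = 0`. -/
lemma expIntegral_mul (τ : ℝ) (m : ℤ) :
    (m : ℂ) * expIntegral τ m = 1 - Complex.exp (Complex.I * τ * m) := by
  have h : ∀ x ∈ uIcc 0 τ, HasDerivAt (fun x : ℝ => -Complex.exp (Complex.I * x * m))
      ((m : ℂ) * (-Complex.I * Complex.exp (Complex.I * x * m))) x := fun x _ => by
    have h1 : HasDerivAt (fun x : ℝ => Complex.exp (Complex.I * x * m))
        (Complex.exp (Complex.I * x * m) * (Complex.I * 1 * m)) x :=
      (((Complex.ofRealCLM.hasDerivAt (x := x)).const_mul Complex.I).mul_const _).cexp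
    refine h1.neg.congr_deriv ?_
    ring
  rw [expIntegral, ← intervalIntegral.integral_const_mul,
    intervalIntegral.integral_eq_sub_of_hasDerivAt h
      (Continuous.intervalIntegrable (by fun_prop) _ _)]
  simp
  ring

lemma expIntegral_zero (τ : ℝ) : expIntegral τ 0 = -Complex.I * τ := by
  simp [expIntegral]
  ring

lemma norm_expIntegral_le {τ : ℝ} (hτ : 0 ≤ τ) (m : ℤ) : ‖expIntegral τ m‖ ≤ τ := by
  have := intervalIntegral.norm_integral_le_of_norm_le_const (a := 0) (b := τ) (C := 1)
    (f := fun x : ℝ => -Complex.I * Complex.exp (Complex.I * x * m)) (fun x _ => by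
      rw [norm_mul, norm_exp_mul_I_int]; simp)
  rwa [sub_zero, one_mul, abs_of_nonneg hτ] at this

lemma norm_expIntegral_sub_le {τ θ : ℝ} (hτ : 0 ≤ τ) (h0 : 0 ≤ θ) (h1 : θ ≤ 1) (m q r : ℤ) :
    ‖expIntegral τ (m + 2 * q * r) - expIntegral τ m‖
      ≤ 2 * τ ^ (θ) * jap q ^ θ * jap r ^ θ * τ := by
  have jq := jap_pos q
  have jr := jap_pos r
  rw [expIntegral, expIntegral, ← intervalIntegral.integral_sub
    (Continuous.intervalIntegrable (by fun_prop) _ _)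
    (Continuous.intervalIntegrable (by fun_prop) _ _)]
  have := intervalIntegral.norm_integral_le_of_norm_le_const (a := 0) (b := τ)
    (C := 2 * τ ^ θ * jap q ^ θ * jap r ^ θ)
    (f := fun x : ℝ => -Complex.I * Complex.exp (Complex.I * x * ((m + 2 * q * r : ℤ) : ℂ))
      - -Complex.I * Complex.exp (Complex.I * x * m)) (fun x hx => ?_)
  · rwa [sub_zero, abs_of_nonneg hτ] at this
  · rw [uIoc_of_le hτ] at hx
    have e : -Complex.I * Complex.exp (Complex.I * x * ((m + 2 * q * r : ℤ) : ℂ))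
      - -Complex.I * Complex.exp (Complex.I * x * m) = -Complex.I * (Complex.exp (Complex.I * x * m)
        * (Complex.exp (Complex.I * x * ((2 * q * r : ℤ) : ℂ)) - 1)) := by
      rw [mul_sub, ← Complex.exp_add, Int.cast_add]
      ring_nf
    rw [e, norm_mul, norm_mul, norm_exp_mul_I_int, norm_neg, Complex.norm_I, one_mul, one_mul]
    have hx0 : 0 ≤ x := hx.1.le
    have h2 : ‖Complex.exp (Complex.I * x * ((2 * q * r : ℤ) : ℂ)) - 1‖
        ≤ 2 * (τ * (jap q * jap r)) := by
      refine (norm_exp_I_mul_sub_one_le x (2 * q * r)).trans ?_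
      rw [abs_of_nonneg hx0]
      push_cast
      rw [abs_mul, abs_mul, abs_two]
      have := mul_le_mul (abs_le_jap q) (abs_le_jap r) (abs_nonneg _) jq.le
      calc x * (2 * |(q : ℝ)| * |(r : ℝ)|) = 2 * (x * (|(q : ℝ)| * |(r : ℝ)|)) := by ring
        _ ≤ _ := by
          have := hx.2
          gcongr
    have h3 := min_two_le_rpow (by positivity) h0 h1 (norm_exp_I_mul_sub_one_le_two x _) h2
    rw [Real.mul_rpow hτ (by positivity), Real.mul_rpow jq.le jr.le] at h3
    exact h3.trans (le_of_eq (by ring))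

/-- The symbol of the error caused by freezing part of the phase. -/
def errSymbol (τ : ℝ) (k p q : ℤ) : ℂ :=
  (if k = 0 then 1 else -(p : ℂ) / k) *
    (expIntegral τ (2 * k * p + 2 * q * (k - p - q)) - expIntegral τ (2 * k * p))

/-- The prefactor `p/k` trades the output weight for `⟨p⟩`. The frozen part of the phase is `2qr`,
and interpolation bounds its effect by `(τ⟨q⟩⟨r⟩)^θ` times the length `τ` of the interval. -/
lemma symbolBound_errSymbol {τ θ : ℝ} (hτ : 0 ≤ τ) (h0 : 0 ≤ θ) (h1 : θ ≤ 1) :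
    SymbolBound (fun k => jap k ^ θ) (4 * (τ ^ θ * τ)) (errSymbol τ) := by
  intro k p q
  have jp := jap_pos p
  have jq := jap_pos q
  have jr := jap_pos (k - p - q)
  have hc : ‖(if k = 0 then 1 else -(p : ℂ) / k)‖ * jap k ≤ 2 * jap p := by
    split_ifs with hk
    · subst hk
      have h2 : jap 0 = 1 := by simp [jap]
      rw [h2]
      simp
      linarith [one_le_jap p]
    · rw [norm_div, norm_neg, Complex.norm_intCast, Complex.norm_intCast]
      exact (norm_div_mul_jap_le (abs_nonneg _) k).trans
        (mul_le_mul_of_nonneg_left (abs_le_jap p) zero_le_two)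
  have hd := norm_expIntegral_sub_le hτ h0 h1 (2 * k * p) q (k - p - q)
  calc ‖errSymbol τ k p q‖ * jap k
      = (‖(if k = 0 then 1 else -(p : ℂ) / k)‖ * jap k) *
        ‖expIntegral τ (2 * k * p + 2 * q * (k - p - q)) - expIntegral τ (2 * k * p)‖ := by
        rw [errSymbol, norm_mul]; ring
    _ ≤ (2 * jap p) * (2 * τ ^ θ * jap q ^ θ * jap (k - p - q) ^ θ * τ) :=
        mul_le_mul hc hd (norm_nonneg _) (by positivity)
    _ = 4 * (τ ^ θ * τ) * (jap p * jap q ^ θ * jap (k - p - q) ^ θ) := by ring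
    _ ≤ _ := by
        refine mul_le_mul_of_nonneg_left ?_ (by positivity)
        have a1 : 0 ≤ jap p ^ θ * jap q * jap (k - p - q) ^ θ := by positivity
        have a2 : 0 ≤ jap p ^ θ * jap q ^ θ * jap (k - p - q) := by positivity
        linarith

/-! ### Decomposition of the Duhamel term -/

lemma duhamelSymbol_eq (τ : ℝ) (k p q : ℤ) :
    duhamelSymbol τ k p q = expIntegral τ (2 * (p + q) * (k - q)) := rfl

/-- A symbol that is antisymmetric under the exchange of the last two frequencies. -/
def antiSymbol (τ : ℝ) (k p q : ℤ) : ℂ :=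
  (((k - q : ℤ) : ℂ) - ((p + q : ℤ) : ℂ)) / k * duhamelSymbol τ k p q

/-- The symbol of the resonant interactions. -/
def resSymbol (τ : ℝ) (k p q : ℤ) : ℂ :=
  if p + q = 0 then -Complex.I * τ * (2 * ((k - q : ℤ) : ℂ) / k) else 0

/-- The form vanishes by symmetry, but its summability is needed to add it to the other series. -/
lemma symbolBound_antiSymbol {τ : ℝ} (hτ : 0 ≤ τ) :
    SymbolBound (fun _ => 1) (4 * τ) (antiSymbol τ) := by
  intro k p q
  simp only [mul_one, one_mul]
  have jp := jap_pos p
  have jq := jap_pos q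
  have jr := jap_pos (k - p - q)
  have e1 : ‖((k - q : ℤ) : ℂ) - ((p + q : ℤ) : ℂ)‖ ≤ 2 * (jap p + jap q + jap (k - p - q)) := by
    refine (norm_sub_le _ _).trans ?_
    rw [Complex.norm_intCast, Complex.norm_intCast]
    linarith [abs_sub_le_jap k p q, abs_add_le_jap p q]
  rw [antiSymbol, norm_mul, norm_div, Complex.norm_intCast]
  calc _ = ‖((k - q : ℤ) : ℂ) - ((p + q : ℤ) : ℂ)‖ / |(k : ℝ)| * jap k * ‖duhamelSymbol τ k p q‖ := by
        ring
    _ ≤ (2 * (2 * (jap p + jap q + jap (k - p - q)))) * τ :=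
        mul_le_mul ((norm_div_mul_jap_le (norm_nonneg _) k).trans
          (mul_le_mul_of_nonneg_left e1 zero_le_two)) (norm_expIntegral_le hτ _) (norm_nonneg _)
          (by positivity)
    _ = _ := by ring

/-- For `k ≠ 0` the left side has weight `1 + ((k-q) - (p+q))/k = 2(k-q)/k - p/k`. Integrating
exactly gives the `∂ₓ⁻¹` terms of the scheme plus the resonance `p+q = 0`; replacing the phase in
the `-p/k` part by `2kp` gives the `∂ₓ⁻²` terms plus the error symbol. -/
lemma duhamelSymbol_add_antiSymbol (τ : ℝ) (k p q : ℤ) :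
    duhamelSymbol τ k p q + antiSymbol τ k p q
      = stepSymbol τ k p q + resSymbol τ k p q + errSymbol τ k p q := by
  have hphase : 2 * k * p + 2 * q * (k - p - q) = 2 * (p + q) * (k - q) := by ring
  rw [errSymbol, antiSymbol, duhamelSymbol_eq, hphase]
  by_cases hk : k = 0
  · subst hk
    simp [stepSymbol, resSymbol, invDerivSymbol, expIntegral_zero]
  have hk' : (k : ℂ) ≠ 0 := by exact_mod_cast hk
  have h1 := expIntegral_mul τ (2 * k * p)
  have h2 := expIntegral_mul τ (2 * (p + q) * (k - q))
  have e1 : -(1 / 2) * invDerivSymbol k ^ 2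
      * (Complex.exp (Complex.I * τ * ((2 * k * p : ℤ) : ℂ)) - 1)
      = -(p : ℂ) / k * expIntegral τ (2 * k * p) := by
    rw [show Complex.exp (Complex.I * τ * ((2 * k * p : ℤ) : ℂ)) - 1
      = -(((2 * k * p : ℤ) : ℂ) * expIntegral τ (2 * k * p)) by rw [h1]; ring]
    simp only [invDerivSymbol, if_neg hk, inv_pow, mul_pow, Complex.I_sq]
    push_cast
    field_simp
  have e2 : invDerivSymbol k * (invDerivSymbol (p + q)
      * (Complex.exp (Complex.I * τ * ((2 * (p + q) * (k - q) : ℤ) : ℂ)) - 1))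
      + resSymbol τ k p q
      = 2 * ((k - q : ℤ) : ℂ) / k * expIntegral τ (2 * (p + q) * (k - q)) := by
    rw [resSymbol]
    by_cases hpq : p + q = 0
    · rw [if_pos hpq, hpq]
      simp only [invDerivSymbol, mul_zero, zero_mul, if_true, zero_add, expIntegral_zero]
      ring
    · have hpq' : (p : ℂ) + q ≠ 0 := by exact_mod_cast hpq
      rw [if_neg hpq, add_zero, show Complex.exp (Complex.I * τ *
        ((2 * (p + q) * (k - q) : ℤ) : ℂ)) - 1 = -(((2 * (p + q) * (k - q) : ℤ) : ℂ)
          * expIntegral τ (2 * (p + q) * (k - q))) by rw [h2]; ring]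
      simp only [invDerivSymbol, if_neg hk, if_neg hpq]
      push_cast
      field_simp
      rw [Complex.I_sq]
      ring
  rw [stepSymbol, if_neg hk, if_neg hk, zero_add, e1, add_assoc (-(p : ℂ) / k * _), e2]
  push_cast
  field_simp
  ring

/-- Exchanging `q` and `r = k-p-q` preserves the phase and flips the sign of the prefactor; the last
two entries must coincide. -/
lemma tri_antiSymbol {a b : ℤ → ℂ} (τ : ℝ) (k : ℤ) : tri (antiSymbol τ) a b b k = 0 := by
  let e : ℤ × ℤ ≃ ℤ × ℤ :=
    ⟨fun i => (i.1, k - i.1 - i.2), fun i => (i.1, k - i.1 - i.2), fun i => by ext <;> simp,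
      fun i => by ext <;> simp⟩
  have h : tri (antiSymbol τ) a b b k = -tri (antiSymbol τ) a b b k := by
    conv_lhs => rw [tri, ← e.tsum_eq]
    rw [tri, ← tsum_neg]
    refine tsum_congr fun i => ?_
    simp only [e, Equiv.coe_fn_mk, antiSymbol, duhamelSymbol_eq]
    rw [show 2 * (i.1 + (k - i.1 - i.2)) * (k - (k - i.1 - i.2)) = 2 * (i.1 + i.2) * (k - i.2) by
      ring, show k - i.1 - (k - i.1 - i.2) = i.2 by ring]
    push_cast
    ring
  exact self_eq_neg.1 h

lemma summable_mom {a : ℤ → ℂ} (ha : SeqH1 a) : Summable fun k : ℤ => (k : ℝ) * ‖a k‖ ^ 2 := by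
  refine Summable.of_norm_bounded ha fun k => ?_
  rw [norm_mul, Real.norm_eq_abs, norm_pow, norm_norm]
  refine mul_le_mul_of_nonneg_right ?_ (by positivity)
  nlinarith [sq_abs (k : ℝ), sq_nonneg (|(k : ℝ)| - 1)]

/-- On `p = -q` the product collapses to `|a_q|² a_k`, and summing the weight `2(k-q)/k` produces
`2M - 2P/k`. -/
lemma tri_resSymbol {a : ℤ → ℂ} (ha : SeqH1 a) (τ : ℝ) (k : ℤ) :
    tri (resSymbol τ) (refl a) a a k = if k = 0 then 0 else
      -Complex.I * ((τ * resonantPhase (seqMass a) (seqMom a) k : ℝ) : ℂ) * a k := by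
  split_ifs with hk
  · subst hk
    have : ∀ p q, resSymbol τ 0 p q = 0 := fun p q => by simp [resSymbol]
    simp [tri, this]
  have hk' : (k : ℂ) ≠ 0 := by exact_mod_cast hk
  have hinj : Function.Injective fun p : ℤ => (-p, p) := fun p q h => (Prod.ext_iff.1 h).2
  have h1 : tri (resSymbol τ) (refl a) a a k = ∑' p : ℤ, (-Complex.I * τ *
      (2 * ((k - p : ℤ) : ℂ) / k)) * (refl a (-p) * a p * a (k - -p - p)) := by
    rw [tri, ← hinj.tsum_eq]
    · simp [resSymbol]
    · intro i hi
      rw [Function.mem_support] at hi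
      have : i.1 + i.2 = 0 := by
        by_contra h
        exact hi (by simp [resSymbol, h])
      exact ⟨i.2, by ext <;> simp; omega⟩
  have h2 : ∀ p : ℤ, (-Complex.I * τ * (2 * ((k - p : ℤ) : ℂ) / k)) *
      (refl a (-p) * a p * a (k - -p - p)) = (-Complex.I * τ * a k) *
        (2 * ((‖a p‖ ^ 2 : ℝ) : ℂ) + (-2 / k) * (((p : ℝ) * ‖a p‖ ^ 2 : ℝ) : ℂ)) := fun p => by
    rw [show k - -p - p = k by ring, refl, neg_neg, Complex.conj_mul']
    push_cast
    field_simp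
    ring
  rw [h1, tsum_congr h2, tsum_mul_left, Summable.tsum_add, tsum_mul_left, tsum_mul_left,
    ← Complex.ofReal_tsum, ← Complex.ofReal_tsum]
  · rw [resonantPhase, if_neg hk, seqMass, seqMom]
    push_cast
    ring
  · exact (Complex.summable_ofReal.2 ha.summable_sq).mul_left _
  · exact (Complex.summable_ofReal.2 (summable_mom ha)).mul_left _

/-- One step of the scheme in the interaction picture, on the Fourier side. -/
def seqStep (τ M P : ℝ) (a : ℤ → ℂ) (k : ℤ) : ℂ :=
  Complex.exp (-Complex.I * ((τ * resonantPhase M P k : ℝ) : ℂ)) * a k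
    + (if k = 0 then 2 * Complex.I * τ * M * a 0 else 0)
    + tri (stepSymbol τ) (refl a) a a k

lemma tri_duhamelSymbol {a : ℤ → ℂ} (ha : SeqH1 a) {τ : ℝ} (hτ : 0 ≤ τ) (k : ℤ) :
    tri (duhamelSymbol τ) (refl a) a a k = tri (stepSymbol τ) (refl a) a a k
      + (-Complex.I * ((τ * resonantPhase (seqMass a) (seqMom a) k : ℝ) : ℂ) * a k
        + if k = 0 then 2 * Complex.I * τ * (seqMass a) * a 0 else 0)
      + tri (errSymbol τ) (refl a) a a k := by
  obtain ⟨S, hS⟩ := exists_isWeight_one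
  have s1 := tri_summable_of_bdd (σ := duhamelSymbol τ)
    (fun k p q => norm_expIntegral_le hτ _) ha.refl ha ha k
  have s2 := tri_summable hS (by positivity) (symbolBound_antiSymbol hτ) ha.refl ha ha k
  have s3 := tri_summable hS (by positivity) (symbolBound_stepSymbol hτ) ha.refl ha ha k
  have s4 := tri_summable (isWeight_rpow (θ := 0) (by norm_num)) (by positivity)
    (symbolBound_errSymbol hτ le_rfl zero_le_one) ha.refl ha ha k
  -- Summability of the resonant series is inherited from the other four through the symbol
  -- identity, which spares a separate bound.
  have s5 : Summable fun i : ℤ × ℤ => resSymbol τ k i.1 i.2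
      * (refl a i.1 * a i.2 * a (k - i.1 - i.2)) := by
    refine (((s1.add s2).sub s3).sub s4).congr fun i => ?_
    linear_combination (refl a i.1 * a i.2 * a (k - i.1 - i.2))
      * duhamelSymbol_add_antiSymbol τ k i.1 i.2
  have hsum : tri (duhamelSymbol τ) (refl a) a a k + tri (antiSymbol τ) (refl a) a a k
      = tri (stepSymbol τ) (refl a) a a k + tri (resSymbol τ) (refl a) a a k
        + tri (errSymbol τ) (refl a) a a k := by
    unfold tri
    rw [← s1.tsum_add s2, ← s3.tsum_add s5, ← (s3.add s5).tsum_add s4]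
    refine tsum_congr fun i => ?_
    linear_combination (refl a i.1 * a i.2 * a (k - i.1 - i.2))
      * duhamelSymbol_add_antiSymbol τ k i.1 i.2
  rw [tri_antiSymbol, add_zero, tri_resSymbol ha] at hsum
  rw [hsum]
  congr 2
  -- At `k = 0` there is no resonant term: the phase there equals `2M`, and the explicit zero-mode
  -- correction cancels it.
  split_ifs with hk
  · subst hk
    simp [resonantPhase]
    ring
  · rw [add_zero]

lemma seqMass_nonneg (a : ℤ → ℂ) : 0 ≤ seqMass a := tsum_nonneg fun _ => by positivity

lemma seqMass_le {a : ℤ → ℂ} (ha : SeqH1 a) : seqMass a ≤ seqNorm a ^ 2 := by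
  rw [seqNorm_sq]
  exact ha.summable_sq.tsum_le_tsum
    (fun k => le_mul_of_one_le_left (by positivity) (by nlinarith [sq_nonneg (k : ℝ)])) ha

lemma abs_seqMom_le {a : ℤ → ℂ} (ha : SeqH1 a) : |seqMom a| ≤ seqNorm a ^ 2 := by
  rw [seqNorm_sq, ← Real.norm_eq_abs]
  refine tsum_of_norm_bounded ha.hasSum fun k => ?_
  rw [norm_mul, Real.norm_eq_abs, norm_pow, norm_norm]
  refine mul_le_mul_of_nonneg_right ?_ (by positivity)
  nlinarith [sq_abs (k : ℝ), sq_nonneg (|(k : ℝ)| - 1)]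

lemma abs_resonantPhase_le {M P D : ℝ} (hM : |M| ≤ D) (hP : |P| ≤ D) (k : ℤ) :
    |resonantPhase M P k| ≤ 4 * D := by
  rw [resonantPhase]
  refine (abs_add_le _ _).trans ?_
  rw [abs_mul, abs_two]
  have hD : 0 ≤ D := (abs_nonneg _).trans hM
  split_ifs with hk
  · rw [abs_zero]; linarith
  · have h1 : (1 : ℝ) ≤ |(k : ℝ)| := by exact_mod_cast Int.one_le_abs hk
    rw [abs_div, abs_mul, abs_neg, abs_two]
    have : 2 * |P| / |(k : ℝ)| ≤ 2 * |P| := div_le_self (by positivity) h1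
    linarith

lemma seqH1_mul_of_norm_le {a m : ℤ → ℂ} {C : ℝ} (ha : SeqH1 a) (hC : 0 ≤ C)
    (hm : ∀ k, ‖m k‖ ≤ C) : SeqH1 (fun k => m k * a k) ∧
      seqNorm (fun k => m k * a k) ≤ C * seqNorm a := by
  have h : ∀ k, ‖m k * a k‖ ≤ C * ‖a k‖ := fun k => by
    rw [norm_mul]; exact mul_le_mul_of_nonneg_right (hm k) (norm_nonneg _)
  exact ⟨ha.of_le C h, seqNorm_le_of_le ha hC h⟩

/-! ### Local error and stability -/

/-- Three sources: the Duhamel remainder `O(τ²)`, the frozen phase `O(τ^{1+θ})`, and the replacement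
of the linear resonant term by its exponential, `O(τ²)`. Since `τ ≤ 1` and `θ ≤ 1`, all are
`O(τ^{1+θ})`. -/
lemma local_error {T B : ℝ} {U : ℝ → ℤ → ℂ} (h : SeqSolution T B U) {S Sθ θ : ℝ}
    (hS : IsWeight (fun _ => 1) S) (hSθ : IsWeight (fun k => jap k ^ θ) Sθ) (hθ0 : 0 ≤ θ)
    (hθ1 : θ ≤ 1) {t τ : ℝ} (h0 : 0 ≤ t) (hτ : 0 < τ) (hτ1 : τ ≤ 1) (hT : t + τ ≤ T) :
    SeqH1 (seqStep τ (seqMass (U t)) (seqMom (U t)) (U t) - twist U t τ) ∧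
    seqNorm (seqStep τ (seqMass (U t)) (seqMom (U t)) (U t) - twist U t τ)
      ≤ (27 * S ^ 2 * B ^ 5 + 12 * Sθ * B ^ 3 + 48 * B ^ 5) * (τ ^ θ * τ) := by
  have hB := h.nonneg (h0.trans (by linarith))
  have m0 : t ∈ Icc 0 T := ⟨h0, by linarith⟩
  have hU := h.seqH1 t m0
  have hUB := h.bound t m0
  have hn := seqNorm_nonneg (U t)
  have hSθ0 := hSθ.sum_nonneg
  have hd := h.duhamel hS h0 hτ hT
  have he := tri_bound hSθ (by positivity) (symbolBound_errSymbol hτ.le hθ0 hθ1) hU.refl hU hU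
  set ω := resonantPhase (seqMass (U t)) (seqMom (U t)) with hω
  have hsq : seqNorm (U t) ^ 2 ≤ B ^ 2 := pow_le_pow_left₀ hn hUB 2
  have hωb : ∀ k, |ω k| ≤ 4 * B ^ 2 := fun k => abs_resonantPhase_le
    (by rw [abs_of_nonneg (seqMass_nonneg _)]; exact (seqMass_le hU).trans hsq)
    ((abs_seqMom_le hU).trans hsq) k
  -- The constant `48 = 3 · 4²` combines the Taylor bound `3y²` with `|ω| ≤ 4B²`.
  have hl := seqH1_mul_of_norm_le (m := fun k => Complex.exp (-Complex.I * ((τ * ω k : ℝ) : ℂ)) - 1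
    - -Complex.I * ((τ * ω k : ℝ) : ℂ)) hU (C := 48 * B ^ 4 * τ ^ 2) (by positivity) (fun k => by
      refine (norm_exp_neg_I_mul_taylor_le _).trans ?_
      have : ω k ^ 2 ≤ (4 * B ^ 2) ^ 2 := by
        rw [← sq_abs]; exact pow_le_pow_left₀ (abs_nonneg _) (hωb k) 2
      rw [mul_pow]
      nlinarith [mul_le_mul_of_nonneg_left this (sq_nonneg τ)])
  have hid : seqStep τ (seqMass (U t)) (seqMom (U t)) (U t) - twist U t τ
      = -(twist U t τ - U t - tri (duhamelSymbol τ) (refl (U t)) (U t) (U t))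
        - tri (errSymbol τ) (refl (U t)) (U t) (U t)
        + fun k => (Complex.exp (-Complex.I * ((τ * ω k : ℝ) : ℂ)) - 1
          - -Complex.I * ((τ * ω k : ℝ) : ℂ)) * U t k := by
    funext k
    simp only [Pi.add_apply, Pi.sub_apply, Pi.neg_apply, seqStep]
    rw [tri_duhamelSymbol hU hτ.le, ← hω]
    ring
  rw [hid]
  refine ⟨(hd.1.neg.sub he.1).add hl.1, ?_⟩
  refine (seqNorm_add_le (hd.1.neg.sub he.1) hl.1).trans ?_
  refine (add_le_add_left (seqNorm_sub_le hd.1.neg he.1) _).trans ?_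
  rw [seqNorm_neg]
  have hττ : τ ^ 2 ≤ τ ^ θ * τ := by
    have := Real.rpow_le_rpow_of_exponent_ge' hτ.le hτ1 hθ0 hθ1
    rw [Real.rpow_one] at this
    nlinarith
  have b1 : τ ^ 2 * (27 * S ^ 2 * B ^ 5) ≤ (τ ^ θ * τ) * (27 * S ^ 2 * B ^ 5) := by gcongr
  have b2 : seqNorm (tri (errSymbol τ) (refl (U t)) (U t) (U t))
      ≤ (τ ^ θ * τ) * (12 * Sθ * B ^ 3) := by
    refine he.2.trans ?_
    rw [seqNorm_refl]
    calc _ ≤ 3 * (4 * (τ ^ θ * τ)) * Sθ * B * B * B := by gcongr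
      _ = _ := by ring
  have b3 : 48 * B ^ 4 * τ ^ 2 * seqNorm (U t) ≤ (τ ^ θ * τ) * (48 * B ^ 5) := by
    calc _ ≤ 48 * B ^ 4 * (τ ^ θ * τ) * B := by gcongr
      _ = _ := by ring
  linarith [hd.2, hl.2]

/-- The exponential multiplier is an isometry; the zero-mode correction and the trilinear part carry
a factor `τ`. Hence the Lipschitz constant is `1 + O(τ)`, with `54 = 9 · 6`. -/
lemma stability {S τ M P B : ℝ} (hS : IsWeight (fun _ => 1) S) (hτ : 0 ≤ τ) {a b : ℤ → ℂ}
    (ha : SeqH1 a) (hb : SeqH1 b) (haB : seqNorm a ≤ B) (hbB : seqNorm b ≤ B) :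
    SeqH1 (seqStep τ M P a - seqStep τ M P b) ∧
    seqNorm (seqStep τ M P a - seqStep τ M P b)
      ≤ (1 + (2 * |M| + 54 * S * B ^ 2) * τ) * seqNorm (a - b) := by
  have hab := ha.sub hb
  have h1 := seqH1_mul_of_norm_le (m := fun k =>
    Complex.exp (-Complex.I * ((τ * resonantPhase M P k : ℝ) : ℂ))) hab zero_le_one
    (fun k => (norm_exp_of_re_zero (by simp)).le)
  have h2 := seqH1_mul_of_norm_le (m := fun k : ℤ => if k = 0 then 2 * Complex.I * τ * M else 0)
    (C := 2 * |M| * τ) hab (by positivity) (fun k => by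
      split_ifs
      · simp [abs_of_nonneg hτ]; linarith
      · simp; positivity)
  have hsb := symbolBound_stepSymbol hτ
  have h3 := tri_sub_bound hS (by positivity) hsb ha.refl ha ha hb.refl hb hb haB haB
    ((seqNorm_refl _).trans_le hbB) hbB (by rw [refl_sub, seqNorm_refl]) le_rfl
    (le_refl (seqNorm (a - b)))
  have h3' := (tri_bound hS (by positivity) hsb ha.refl ha ha).1.sub
    (tri_bound hS (by positivity) hsb hb.refl hb hb).1
  have hid : seqStep τ M P a - seqStep τ M P b
      = (fun k => Complex.exp (-Complex.I * ((τ * resonantPhase M P k : ℝ) : ℂ)) * (a - b) k)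
        + (fun k : ℤ => (if k = 0 then 2 * Complex.I * τ * M else 0) * (a - b) k)
        + (tri (stepSymbol τ) (refl a) a a - tri (stepSymbol τ) (refl b) b b) := by
    funext k
    simp only [Pi.add_apply, Pi.sub_apply, seqStep]
    split_ifs with hk
    · subst hk; ring
    · ring
  rw [hid]
  refine ⟨(h1.1.add h2.1).add h3', ?_⟩
  refine (seqNorm_add_le (h1.1.add h2.1) h3').trans ?_
  refine (add_le_add_left (seqNorm_add_le h1.1 h2.1) _).trans ?_
  linarith [h1.2, h2.2, h3]

/-! ### Global error -/

/-- The essential bound holds on a dense set of times and passes to every time, endpoints included,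
by continuity in `H¹`. -/
lemma IsNLSSolution.seqNorm_coeff_le {T : ℝ} (hT : 0 < T) {R : ℝ≥0} {u₀ : Torus → ℂ}
    {u : ℝ → Torus → ℂ} (h : IsNLSSolution T u₀ u) (hR : linftyH1Norm T u ≤ (R : ℝ≥0∞)) :
    ∀ t ∈ Icc 0 T, seqNorm (coeff (u t)) ≤ R := by
  have hpi : 1 ≤ √(2 * Real.pi) := by
    rw [Real.one_le_sqrt]; linarith [Real.pi_gt_three]
  have hle : ∀ f, seqNorm (coeff f) ≤ h1Norm f := fun f => by
    rw [h1Norm_eq]; exact le_mul_of_one_le_left (seqNorm_nonneg _) hpi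
  have hae : ∀ᵐ s : ℝ, s ∈ Ioo 0 T → h1Norm (u s) ≤ R := by
    rw [← ae_restrict_iff' measurableSet_Ioo]
    rw [linftyH1Norm, eLpNorm_exponent_top] at hR
    filter_upwards [ae_le_eLpNormEssSup (f := fun t => h1Norm (u t))
      (μ := volume.restrict (Ioo 0 T))] with s hs
    have h1 := hs.trans hR
    rw [← ofReal_norm, ← ENNReal.ofReal_coe_nnreal,
      ENNReal.ofReal_le_ofReal_iff R.coe_nonneg] at h1
    exact (Real.le_norm_self _).trans h1
  have hdense := Measure.dense_of_ae hae
  intro t ht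
  refine le_of_forall_pos_le_add fun δ hδ => ?_
  have hc := (h.continuous_H1 t ht).eventually (gt_mem_nhds hδ)
  rw [eventually_nhdsWithin_iff, Metric.eventually_nhds_iff] at hc
  obtain ⟨r, hr, hc⟩ := hc
  have hne : (Ioo (max (t - r) 0) (min (t + r) T)).Nonempty := by
    rw [nonempty_Ioo, max_lt_iff, lt_min_iff, lt_min_iff]
    exact ⟨⟨by linarith, by linarith [ht.2]⟩, by linarith [ht.1], hT⟩
  obtain ⟨s, hs, hsR⟩ := hdense.inter_open_nonempty _ isOpen_Ioo hne
  rw [mem_Ioo, max_lt_iff, lt_min_iff] at hs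
  have hs0 : s ∈ Ioo 0 T := ⟨hs.1.2, hs.2.2⟩
  have hsI := Ioo_subset_Icc_self hs0
  have h1 := hc (y := s) (by rw [Real.dist_eq, abs_lt]; constructor <;> linarith [hs.1.1, hs.2.1])
    hsI
  have h2 := hsR hs0
  have e : coeff (u t) = coeff (u s) - coeff (u s - u t) := by
    rw [coeff_sub (h.memH1 s hsI) (h.memH1 t ht)]; abel
  rw [e]
  refine (seqNorm_sub_le (h.memH1 s hsI).seqH1
    ((h.memH1 s hsI).sub (h.memH1 t ht)).seqH1).trans ?_
  linarith [hle (u s), hle (u s - u t)]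

lemma IsNLSSolution.seqSolution {T : ℝ} (hT : 0 < T) {R : ℝ≥0} {u₀ : Torus → ℂ}
    {u : ℝ → Torus → ℂ} (h : IsNLSSolution T u₀ u) (hR : linftyH1Norm T u ≤ (R : ℝ≥0∞)) :
    SeqSolution T R (fun t => coeff (u t)) where
  seqH1 t ht := (h.memH1 t ht).seqH1
  bound := h.seqNorm_coeff_le hT hR
  cont k t ht := by
    have hpi : 1 ≤ √(2 * Real.pi) := by
      rw [Real.one_le_sqrt]; linarith [Real.pi_gt_three]
    refine tendsto_iff_norm_sub_tendsto_zero.2 (squeeze_zero' (Eventually.of_forall fun _ =>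
      norm_nonneg _) ?_ (h.continuous_H1 t ht))
    filter_upwards [self_mem_nhdsWithin] with s hs
    have e : coeff (u s) k - coeff (u t) k = coeff (u s - u t) k := by
      rw [coeff_sub (h.memH1 s hs) (h.memH1 t ht)]; rfl
    rw [e, h1Norm_eq]
    exact (norm_le_seqNorm ((h.memH1 s hs).sub (h.memH1 t ht)).seqH1 k).trans
      (le_mul_of_one_le_left (seqNorm_nonneg _) hpi)
  deriv t ht k := by
    obtain ⟨d, hd, he⟩ := h.equation t ht k
    refine hd.congr_deriv ?_
    rw [← coeff_absSq_mul (h.memH1 t (Ioo_subset_Icc_self ht))]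
    linear_combination -Complex.I * he + d * Complex.I_sq

/-- The free group is isometric, so the new error can be measured in the interaction picture and
split into stability plus local error. Conservation lets the frozen mass and momentum of `u₀` stand
for those at time `nτ`. The radius `R + 1` leaves room for a numerical error of size one. -/
lemma error_step {T : ℝ} (hT : 0 < T) {R : ℝ≥0} {u₀ : Torus → ℂ} {u : ℝ → Torus → ℂ}
    (hu₀ : MemH1 u₀) (h : IsNLSSolution T u₀ u) (hR : linftyH1Norm T u ≤ (R : ℝ≥0∞)) {S Sθ θ : ℝ}
    (hS : IsWeight (fun _ => 1) S) (hSθ : IsWeight (fun k => jap k ^ θ) Sθ) (hθ0 : 0 ≤ θ)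
    (hθ1 : θ ≤ 1) {τ : ℝ} (hτ : 0 < τ) (hτ1 : τ ≤ 1) {n : ℕ} (hn : ((n + 1 : ℕ) : ℝ) * τ ≤ T)
    (hZ : MemH1 (numSol τ u₀ n)) (hZb : seqNorm (coeff (numSol τ u₀ n)) ≤ R + 1) :
    MemH1 (numSol τ u₀ (n + 1)) ∧
    seqNorm (coeff (numSol τ u₀ (n + 1)) - coeff (u (((n + 1 : ℕ) : ℝ) * τ)))
      ≤ (1 + (2 * (R : ℝ) ^ 2 + 54 * S * (R + 1) ^ 2) * τ)
          * seqNorm (coeff (numSol τ u₀ n) - coeff (u ((n : ℝ) * τ)))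
        + (27 * S ^ 2 * R ^ 5 + 12 * Sθ * R ^ 3 + 48 * R ^ 5) * (τ ^ θ * τ) := by
  have hsol := h.seqSolution hT hR
  set U : ℝ → ℤ → ℂ := fun t => coeff (u t) with hU
  set t : ℝ := (n : ℝ) * τ with ht
  have hRn : (0 : ℝ) ≤ R := R.coe_nonneg
  have ht0 : 0 ≤ t := by positivity
  have htτ : ((n + 1 : ℕ) : ℝ) * τ = t + τ := by push_cast; ring
  rw [htτ] at hn ⊢
  have htT : t < T := by linarith
  have hUt := hsol.seqH1 t ⟨ht0, htT.le⟩
  have hUb := hsol.bound t ⟨ht0, htT.le⟩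
  have hU0 : U 0 = coeff u₀ := fourierCoeff_congr_ae h.initial
  have hM : seqMass (U t) = seqMass (coeff u₀) := by
    have := hsol.conserved 1 0 ht0 htT
    simpa [seqMass, hU0] using this
  have hMb : |seqMass (coeff u₀)| ≤ (R : ℝ) ^ 2 := by
    rw [← hM, abs_of_nonneg (seqMass_nonneg _)]
    exact (seqMass_le hUt).trans (pow_le_pow_left₀ (seqNorm_nonneg _) hUb 2)
  have hP : seqMom (U t) = seqMom (coeff u₀) := by
    have := hsol.conserved 0 1 ht0 htT
    simpa [seqMom, hU0] using this
  have hst := memH1_step τ (seqMass (coeff u₀)) (seqMom (coeff u₀)) hZ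
  have hnum : numSol τ u₀ (n + 1) = step τ (seqMass (coeff u₀)) (-Complex.I * seqMom (coeff u₀))
      (numSol τ u₀ n) := by
    rw [numSol, mass_eq hu₀, momentum_eq hu₀]
  rw [hnum]
  refine ⟨hst.1, ?_⟩
  set M := seqMass (coeff u₀)
  set P := seqMom (coeff u₀)
  set Z := coeff (numSol τ u₀ n)
  have hnorm : seqNorm (coeff (step τ M (-Complex.I * P) (numSol τ u₀ n)) - U (t + τ))
      = seqNorm (seqStep τ M P Z - twist U t τ) := by
    refine seqNorm_congr fun k => ?_
    have e1 : U (t + τ) k = Complex.exp (-Complex.I * (τ : ℂ) * (k : ℂ) ^ 2) * twist U t τ k := by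
      rw [twist, ← mul_assoc, ← Complex.exp_add]
      push_cast
      rw [show -Complex.I * (τ : ℂ) * (k : ℂ) ^ 2 + Complex.I * τ * (k : ℂ) ^ 2 = 0 by ring,
        Complex.exp_zero, one_mul]
    rw [Pi.sub_apply, Pi.sub_apply, hst.2 k, e1, ← mul_sub, norm_mul, norm_freeSymbol, one_mul]
    rfl
  have hloc := local_error hsol hS hSθ hθ0 hθ1 ht0 hτ hτ1 hn
  rw [hM, hP] at hloc
  have hstab := stability (M := M) (P := P) hS hτ.le hZ.seqH1 hUt hZb (by linarith)
  change seqNorm (coeff (step τ M (-Complex.I * P) (numSol τ u₀ n)) - U (t + τ)) ≤ _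
  rw [hnorm, show seqStep τ M P Z - twist U t τ = (seqStep τ M P Z - seqStep τ M P (U t))
    + (seqStep τ M P (U t) - twist U t τ) by abel]
  refine (seqNorm_add_le hstab.1 hloc.1).trans (add_le_add (hstab.2.trans ?_) hloc.2)
  have := seqNorm_nonneg (Z - U t)
  gcongr

/-- Keeping the factor `nτ` beside the exponential gives an invariant that also covers `K = 0`. -/
lemma gronwall_step {K L τ e e' x : ℝ} {n : ℕ} (hK : 0 ≤ K) (hL : 0 ≤ L) (hτ : 0 ≤ τ)
    (hx : 0 ≤ x) (h : e ≤ n * τ * L * x * Real.exp (K * (n * τ)))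
    (h' : e' ≤ (1 + K * τ) * e + L * (x * τ)) :
    e' ≤ (n + 1 : ℕ) * τ * L * x * Real.exp (K * ((n + 1 : ℕ) * τ)) := by
  have h1 : 1 + K * τ ≤ Real.exp (K * τ) := by linarith [Real.add_one_le_exp (K * τ)]
  have h2 : 1 ≤ Real.exp (K * ((n + 1 : ℕ) * τ)) := Real.one_le_exp (by positivity)
  have h3 : Real.exp (K * ((n + 1 : ℕ) * τ)) = Real.exp (K * τ) * Real.exp (K * (n * τ)) := by
    rw [← Real.exp_add]; congr 1; push_cast; ring
  have h4 : 0 ≤ n * τ * L * x * Real.exp (K * (n * τ)) := by positivity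
  calc e' ≤ (1 + K * τ) * e + L * (x * τ) := h'
    _ ≤ (1 + K * τ) * (n * τ * L * x * Real.exp (K * (n * τ))) + L * (x * τ) := by gcongr
    _ ≤ Real.exp (K * τ) * (n * τ * L * x * Real.exp (K * (n * τ)))
        + L * (x * τ) * Real.exp (K * ((n + 1 : ℕ) * τ)) := by
        refine add_le_add (mul_le_mul_of_nonneg_right h1 h4) ?_
        exact le_mul_of_one_le_right (by positivity) h2
    _ = _ := by rw [h3]; push_cast; ring

lemma gronwall_bound {K L τ x T : ℝ} {n : ℕ} (hK : 0 ≤ K) (hL : 0 ≤ L) (hτ : 0 ≤ τ)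
    (hx : 0 ≤ x) (hn : n * τ ≤ T) :
    n * τ * L * x * Real.exp (K * (n * τ)) ≤ T * L * Real.exp (K * T) * x := by
  have hT : 0 ≤ T := le_trans (by positivity) hn
  calc n * τ * L * x * Real.exp (K * (n * τ)) ≤ T * L * x * Real.exp (K * T) := by gcongr
    _ = _ := by ring

end NLSTorus

end

/-! ### Bootstrap and convergence rate -/

theorem corollary1p2 (T : ℝ) (hT : 0 < T) (R : ℝ≥0) :
    ∃ τ₀ : ℝ, 0 < τ₀ ∧ ∀ ε : ℝ, 0 < ε → ∃ C : ℝ, 0 < C ∧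
      ∀ (u₀ : NLSTorus.Torus → ℂ) (u : ℝ → NLSTorus.Torus → ℂ),
        NLSTorus.MemH1 u₀ → NLSTorus.IsNLSSolution T u₀ u →
        NLSTorus.linftyH1Norm T u ≤ (R : ℝ≥0∞) →
        ∀ τ : ℝ, 0 < τ → τ ≤ τ₀ → ∀ n : ℕ, (n : ℝ) * τ ≤ T →
          NLSTorus.MemH1 (u ((n : ℝ) * τ) - NLSTorus.numSol τ u₀ n) ∧
          NLSTorus.h1Norm (u ((n : ℝ) * τ) - NLSTorus.numSol τ u₀ n)
            ≤ C * τ ^ (1 / 2 - ε) := by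
  obtain ⟨S, hS⟩ := NLSTorus.exists_isWeight_one
  have hS0 := hS.sum_nonneg
  have hR : (0 : ℝ) ≤ R := R.coe_nonneg
  set K : ℝ := 2 * (R : ℝ) ^ 2 + 54 * S * (R + 1) ^ 2 with hK
  have hK0 : 0 ≤ K := by positivity
  have hw := fun (θ : ℝ) (h : θ < 1 / 2) => NLSTorus.isWeight_rpow h
  set L : ℝ → ℝ := fun θ => 27 * S ^ 2 * (R : ℝ) ^ 5
    + 12 * (∑' k : ℤ, (NLSTorus.jap k ^ θ / NLSTorus.jap k) ^ 2) * R ^ 3 + 48 * R ^ 5 with hL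
  have hL0 : ∀ θ, 0 ≤ L θ := fun θ => by
    have : 0 ≤ ∑' k : ℤ, (NLSTorus.jap k ^ θ / NLSTorus.jap k) ^ 2 :=
      tsum_nonneg fun _ => sq_nonneg _
    positivity
  set A : ℝ → ℝ := fun θ => T * L θ * Real.exp (K * T) with hA
  have hA0 : ∀ θ, 0 ≤ A θ := fun θ => by have := hL0 θ; positivity
  have hA4 := hA0 (1 / 4)
  have hq0 : 0 < (1 / (A (1 / 4) + 1)) ^ 4 := by positivity
  -- The fourth power inverts `τ^{1/4}`, so the a priori error `A(1/4) τ^{1/4}` is at most `1`;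
  -- adding `1` keeps the quotient defined.
  refine ⟨min 1 ((1 / (A (1 / 4) + 1)) ^ 4), lt_min one_pos hq0, fun ε hε => ?_⟩
  -- The maximum keeps the exponent at least `1/4` when `ε` is large; since `τ ≤ 1`, a larger
  -- exponent only helps.
  refine ⟨√(2 * Real.pi) * (A (max (1 / 2 - ε) (1 / 4)) + 1),
    mul_pos (Real.sqrt_pos.2 Real.two_pi_pos) (by linarith [hA0 (max (1 / 2 - ε) (1 / 4))]), ?_⟩
  intro u₀ u hu₀ hu hub τ hτ hττ
  have hτ1 : τ ≤ 1 := hττ.trans (min_le_left _ _)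
  have hsmall : A (1 / 4) * τ ^ (1 / 4 : ℝ) ≤ 1 := by
    have h1 : τ ^ (1 / 4 : ℝ) ≤ 1 / (A (1 / 4) + 1) := by
      have := Real.rpow_le_rpow hτ.le (hττ.trans (min_le_right _ _))
        (show (0 : ℝ) ≤ 1 / 4 by norm_num)
      refine this.trans (le_of_eq ?_)
      rw [← Real.rpow_natCast, ← Real.rpow_mul (by positivity)]
      norm_num
    calc A (1 / 4) * τ ^ (1 / 4 : ℝ) ≤ A (1 / 4) * (1 / (A (1 / 4) + 1)) := by gcongr
      _ ≤ 1 := by rw [mul_one_div, div_le_one (by linarith)]; linarith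
  have hUb := hu.seqNorm_coeff_le hT hub
  have hI : ∀ n : ℕ, (n : ℝ) * τ ≤ T → (n : ℝ) * τ ∈ Icc 0 T := fun n hn => ⟨by positivity, hn⟩
  have hinit : NLSTorus.coeff (NLSTorus.numSol τ u₀ 0) - NLSTorus.coeff (u ((0 : ℕ) * τ)) = 0 := by
    rw [Nat.cast_zero, zero_mul, sub_eq_zero]
    exact (fourierCoeff_congr_ae hu.initial).symm
  have hzero : NLSTorus.seqNorm 0 = 0 := by simp [NLSTorus.seqNorm]
  have hstep : ∀ n : ℕ, (n : ℝ) * τ ≤ T → NLSTorus.MemH1 (NLSTorus.numSol τ u₀ n) →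
      NLSTorus.seqNorm (NLSTorus.coeff (NLSTorus.numSol τ u₀ n) - NLSTorus.coeff (u (n * τ))) ≤ 1 →
      NLSTorus.seqNorm (NLSTorus.coeff (NLSTorus.numSol τ u₀ n)) ≤ R + 1 := by
    intro n hn hZ h1
    have hUn := (hu.memH1 _ (hI n hn)).seqH1
    rw [show NLSTorus.coeff (NLSTorus.numSol τ u₀ n) = NLSTorus.coeff (u (n * τ))
      + (NLSTorus.coeff (NLSTorus.numSol τ u₀ n) - NLSTorus.coeff (u (n * τ))) by abel]
    refine (NLSTorus.seqNorm_add_le hUn (hZ.seqH1.sub hUn)).trans (add_le_add (hUb _ (hI n hn)) h1)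
  -- First pass, with exponent `1/4`: the induction bound itself keeps the error below `1`, which
  -- licenses the next application of stability.
  have hbdd : ∀ n : ℕ, (n : ℝ) * τ ≤ T → NLSTorus.MemH1 (NLSTorus.numSol τ u₀ n) ∧
      NLSTorus.seqNorm (NLSTorus.coeff (NLSTorus.numSol τ u₀ n) - NLSTorus.coeff (u (n * τ)))
        ≤ n * τ * L (1 / 4) * τ ^ (1 / 4 : ℝ) * Real.exp (K * (n * τ)) := by
    intro n
    induction n with
    | zero => exact fun _ => ⟨hu₀, by rw [hinit, hzero]; simp⟩
    | succ n ih =>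
      intro hn
      have hn' : (n : ℝ) * τ ≤ T := le_trans (by push_cast; nlinarith) hn
      obtain ⟨hZ, he⟩ := ih hn'
      have h1 := hstep n hn' hZ ((he.trans (NLSTorus.gronwall_bound hK0 (hL0 _) hτ.le
        (by positivity) hn')).trans hsmall)
      obtain ⟨hZ', he'⟩ := NLSTorus.error_step hT hu₀ hu hub hS (hw (1 / 4) (by norm_num))
        (by norm_num) (by norm_num) hτ hτ1 hn hZ h1
      exact ⟨hZ', NLSTorus.gronwall_step hK0 (hL0 _) hτ.le (by positivity) he he'⟩
  have hone : ∀ n : ℕ, (n : ℝ) * τ ≤ T → NLSTorus.seqNorm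
      (NLSTorus.coeff (NLSTorus.numSol τ u₀ n) - NLSTorus.coeff (u (n * τ))) ≤ 1 := fun n hn =>
    ((hbdd n hn).2.trans (NLSTorus.gronwall_bound hK0 (hL0 _) hτ.le (by positivity) hn)).trans
      hsmall
  set θ := max (1 / 2 - ε) (1 / 4) with hθ
  have hθ0 : 0 ≤ θ := le_trans (by norm_num) (le_max_right _ _)
  have hθ1 : θ < 1 / 2 := max_lt (by linarith) (by norm_num)
  -- Second pass, with the target exponent: the size bound is already known, so no further smallness
  -- of `τ` is required.
  have herr : ∀ n : ℕ, (n : ℝ) * τ ≤ T →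
      NLSTorus.seqNorm (NLSTorus.coeff (NLSTorus.numSol τ u₀ n) - NLSTorus.coeff (u (n * τ)))
        ≤ n * τ * L θ * τ ^ θ * Real.exp (K * (n * τ)) := by
    intro n
    induction n with
    | zero => exact fun _ => by rw [hinit, hzero]; simp
    | succ n ih =>
      intro hn
      have hn' : (n : ℝ) * τ ≤ T := le_trans (by push_cast; nlinarith) hn
      have hZ := (hbdd n hn').1
      exact NLSTorus.gronwall_step hK0 (hL0 _) hτ.le (by positivity) (ih hn')
        (NLSTorus.error_step hT hu₀ hu hub hS (hw θ hθ1) hθ0 (by linarith) hτ hτ1 hn hZ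
          (hstep n hn' hZ (hone n hn'))).2
  intro n hn
  have hZ := (hbdd n hn).1
  have hUn := hu.memH1 _ (hI n hn)
  refine ⟨hUn.sub hZ, ?_⟩
  rw [NLSTorus.h1Norm_eq, NLSTorus.coeff_sub hUn hZ, mul_assoc, ← NLSTorus.seqNorm_neg, neg_sub]
  refine mul_le_mul_of_nonneg_left ?_ (Real.sqrt_nonneg _)
  refine ((herr n hn).trans (NLSTorus.gronwall_bound hK0 (hL0 _) hτ.le (by positivity) hn)).trans ?_
  exact mul_le_mul (by linarith) (Real.rpow_le_rpow_of_exponent_ge hτ hτ1 (le_max_left _ _))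
    (by positivity) (by linarith [hA0 θ])
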